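/- **Theorem 1.3.** Let $(D,\mu)$ be a measure space, let $m\ge 1$, let $a=(a_1,\dots,a_m)^\top$ be a family of complex-valued square-integrable functions on $D$, and let $b=(b_k)_{k\in\mathbb I}^\top$ be a family of complex-valued square-integrable functions on $D$, where the index set $\mathbb I$ is nonempty and at most countable. (Functions are defined at every point of $D$, not up to null sets.) Put $$I:=\int_D a(x)a(x)^*\,d\mu(x)\in\mathbb C^{m\times m},\qquad J:=\int_D b(x)b(x)^*\,d\mu(x)\in\mathbb C^{\mathbb I\times\mathbb I},$$ the integrals being taken entrywise. Possibly infinite matrices are regarded as operators on $\ell_2(\mathbb I)$, and $\lambda_{\min}$, $\lambda_{\max}$ denote the smallest and the largest eigenvalue. Assume that $$\sum_{k\in\mathbb I}\|b_k\|_{L_2(D,\mu)}^2<\infty$$ and that $I$ and $J$ are positive definite, that is, they are self-adjoint with $v^*Iv>0$ for all nonzero $v\in\mathbb C^m$ and $v^*Jv>0$ for all nonzero $v\in\ell_2(\mathbb I)$. Then $\operatorname{Tr}(J)=\sum_{k\in\mathbb I}\|b_k\|_{L_2(D,\mu)}^2$, the operator $J$ has a largest eigenvalue $\lambda_{\max}(J)$,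 and with the effective dimension $$M:=\frac{\operatorname{Tr}(J)}{\lambda_{\max}(J)}$$ the following holds. For every integer $n\ge m$ there exist points $x_1,\dots,x_n\in D$ and weights $w_1,\dots,w_n>0$ such that $$\lambda_{\min}\Big(\sum_{i=1}^n w_i\,a(x_i)a(x_i)^*\Big)\ \ge\ \Big(1-\sqrt{\tfrac{m-1}{n}}\Big)^2\lambda_{\min}(I),$$ and such that $b(x_i)\in\ell_2(\mathbb I)$ for all $i$, the operator $\sum_{i=1}^n w_i\,b(x_i)b(x_i)^*$ on $\ell_2(\mathbb I)$ has a largest eigenvalue, and $$\lambda_{\max}\Big(\sum_{i=1}^n w_i\,b(x_i)b(x_i)^*\Big)\ \le\ \Big(1+\sqrt{\tfrac{M-1}{n}}\Big)^2\lambda_{\max}(J).$$ -/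

import Mathlib

open MeasureTheory
open scoped ComplexConjugate ComplexOrder

noncomputable section

/-- The Hilbert space `ℓ₂(ι)` of complex square-summable families indexed by `ι`. -/
abbrev Ell2 (ι : Type*) : Type _ := lp (fun _ : ι => ℂ) 2

/-- The matrix `∫ f(x) f(x)^* dμ(x)`, with entries `∫ f_k(x) \overline{f_l(x)} dμ(x)`, of a
(possibly infinite) family `f = (f_k)` of functions. -/
def integralMatrix {D ι : Type*} [MeasurableSpace D] (μ : Measure D) (f : ι → D → ℂ) :
    Matrix ι ι ℂ :=
  Matrix.of fun k l => ∫ x, f k x * conj (f l x) ∂μ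

/-- The matrix `∑_i w_i f(x_i) f(x_i)^*`, with entries `∑_i w_i f_k(x_i) \overline{f_l(x_i)}`. -/
def sampleMatrix {D ι : Type*} {n : ℕ} (x : Fin n → D) (w : Fin n → ℝ) (f : ι → D → ℂ) :
    Matrix ι ι ℂ :=
  Matrix.of fun k l => ∑ i, (w i : ℂ) * (f k (x i) * conj (f l (x i)))

/-- `A v = u` for a possibly infinite matrix `A` and `v, u ∈ ℓ₂(ι)`: the entries of `A v` are
given by (convergent) row sums. -/
def IsMulVecEll2 {ι : Type*} (A : Matrix ι ι ℂ) (v u : Ell2 ι) : Prop :=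
  ∀ k, HasSum (fun l => A k l * v l) (u k)

/-- Positive definiteness of a possibly infinite matrix as an operator on `ℓ₂(ι)`:
`A^* = A`, and for all nonzero `v ∈ ℓ₂(ι)` the vector `A v` exists in `ℓ₂(ι)` and
`v^* A v > 0`. -/
def PosDefEll2 {ι : Type*} (A : Matrix ι ι ℂ) : Prop :=
  A.IsHermitian ∧
    ∀ v : Ell2 ι, v ≠ 0 → ∃ u : Ell2 ι, IsMulVecEll2 A v u ∧ 0 < (inner ℂ v u).re

/-- The real eigenvalues of a possibly infinite matrix acting on `ℓ₂(ι)`. For the self-adjoint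
matrices considered here, these are all its eigenvalues. -/
def eigenvaluesEll2 {ι : Type*} (A : Matrix ι ι ℂ) : Set ℝ :=
  {t | ∃ v : Ell2 ι, v ≠ 0 ∧ IsMulVecEll2 A v ((t : ℂ) • v)}

/-- The largest eigenvalue of a self-adjoint, possibly infinite matrix acting on `ℓ₂(ι)`. -/
def lambdaMax {ι : Type*} (A : Matrix ι ι ℂ) : ℝ :=
  sSup (eigenvaluesEll2 A)

/-- The smallest eigenvalue of a Hermitian `m × m` matrix. -/
def lambdaMin {m : ℕ} (A : Matrix (Fin m) (Fin m) ℂ) : ℝ :=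
  sInf {t : ℝ | Module.End.HasEigenvalue (Matrix.toLin' A) (t : ℂ)}

/-- The trace of a self-adjoint, possibly infinite matrix (whose diagonal is real). -/
def traceEll2 {ι : Type*} (A : Matrix ι ι ℂ) : ℝ :=
  ∑' k, (A k k).re

/-- The effective dimension `Tr(A) / λ_max(A)`. -/
def effectiveDim {ι : Type*} (A : Matrix ι ι ℂ) : ℝ :=
  traceEll2 A / lambdaMax A

end

/-! The argument is the two-barrier method of Batson, Spielman and Srivastava. The barriers move by
multiples of the frame operator `K = ∫ f f^*`, and the potential of a strictly positive slack `P` is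
`Φ(P) = ∫ ⟪f, P⁻¹ f⟫`, morally `Tr(P⁻¹ K)`. Both families are read as square-integrable `ℓ₂`-valued
fields, one for each barrier.

By Sherman–Morrison, a sample of weight `w` at `x` does not raise the upper potential if `w U(x) ≤
1`, nor the lower one if `w L(x) ≥ 1`. Resolvent estimates (`mul_integral_le_barrierPotential_sub`,
`barrierPotential_sub_le_mul_integral`) give `∫ U ≤ 1 ≤ ∫ L`, so some point has `U ≤ L` and `L > 0`,
and `w = 1 / L` serves both barriers (`exists_weighted_sample`).

The lower slack starts at a multiple `c K`, with `Φ = m / c`. The upper one starts at `c • 1`, since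
a compact `K` need not be invertible; there `Φ = Tr(J) / c`, which is how the effective dimension
enters. At the end `K ≤ Φ(P) P` (`quadForm_frameOp_le_potential_mul`) turns the potential bound into
extra slack; this gives `m - 1` and `M - 1` in place of `m` and `M`. Largest eigenvalues exist
because the operators involved are positive and compact. -/

/-! ### Quadratic forms, inverses and rank-one updates. -/

section OperatorForms

open Ring InnerProductSpace

variable {H : Type*} [NormedAddCommGroup H] [InnerProductSpace ℂ H]

/-- The real quadratic form `re ⟪x, T x⟫` of a bounded operator `T`. -/
noncomputable def quadForm (T : H →L[ℂ] H) (x : H) : ℝ := (inner ℂ x (T x)).re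

@[simp] lemma quadForm_add (S T : H →L[ℂ] H) (x : H) :
    quadForm (S + T) x = quadForm S x + quadForm T x := by
  simp [quadForm]

@[simp] lemma quadForm_sub (S T : H →L[ℂ] H) (x : H) :
    quadForm (S - T) x = quadForm S x - quadForm T x := by
  simp [quadForm]

@[simp] lemma quadForm_smul (c : ℝ) (T : H →L[ℂ] H) (x : H) :
    quadForm (c • T) x = c * quadForm T x := by
  simp [quadForm, inner_smul_right_eq_smul]

@[simp] lemma quadForm_zero (x : H) : quadForm (0 : H →L[ℂ] H) x = 0 := by simp [quadForm]

@[simp] lemma quadForm_one (x : H) : quadForm (1 : H →L[ℂ] H) x = ‖x‖ ^ 2 := by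
  simpa [quadForm] using inner_self_eq_norm_sq (𝕜 := ℂ) x

@[simp] lemma quadForm_rankOne (v x : H) :
    quadForm (rankOne ℂ v v) x = ‖inner ℂ v x‖ ^ 2 := by
  simp only [quadForm, rankOne_apply, inner_smul_right]
  rw [← inner_conj_symm x v, Complex.mul_conj, Complex.normSq_eq_norm_sq, Complex.ofReal_re]

lemma continuous_quadForm (T : H →L[ℂ] H) : Continuous (quadForm T) := by
  unfold quadForm; fun_prop

lemma abs_quadForm_le (T : H →L[ℂ] H) (x : H) : |quadForm T x| ≤ ‖T‖ * ‖x‖ ^ 2 := by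
  calc |quadForm T x| ≤ ‖inner ℂ x (T x)‖ := Complex.abs_re_le_norm _
    _ ≤ ‖x‖ * ‖T x‖ := norm_inner_le_norm _ _
    _ ≤ ‖x‖ * (‖T‖ * ‖x‖) := by gcongr; exact T.le_opNorm x
    _ = _ := by ring

variable [CompleteSpace H]

omit [CompleteSpace H] in
lemma inner_map_comm_of_nonneg {T : H →L[ℂ] H} (hT : 0 ≤ T) (x y : H) :
    inner ℂ (T x) y = inner ℂ x (T y) :=
  ((ContinuousLinearMap.nonneg_iff_isPositive T).1 hT).isSymmetric x y

lemma nonneg_iff_quadForm {T : H →L[ℂ] H} :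
    0 ≤ T ↔ IsSelfAdjoint T ∧ ∀ x, 0 ≤ quadForm T x := by
  rw [ContinuousLinearMap.nonneg_iff_isPositive, ContinuousLinearMap.isPositive_def']
  refine and_congr_right fun h => forall_congr' fun x => ?_
  rw [ContinuousLinearMap.reApplyInnerSelf_apply, ← inner_re_symm]
  rfl

lemma quadForm_nonneg {T : H →L[ℂ] H} (hT : 0 ≤ T) (x : H) : 0 ≤ quadForm T x :=
  (nonneg_iff_quadForm.1 hT).2 x

omit [CompleteSpace H] in
lemma rankOne_self_nonneg (v : H) : (0 : H →L[ℂ] H) ≤ rankOne ℂ v v :=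
  (ContinuousLinearMap.nonneg_iff_isPositive _).2 (isPositive_rankOne_self v)

/-- Cauchy–Schwarz for the semi-inner product of a positive operator. -/
lemma norm_inner_sq_le_quadForm_mul {T : H →L[ℂ] H} (hT : 0 ≤ T) (x y : H) :
    ‖inner ℂ x (T y)‖ ^ 2 ≤ quadForm T x * quadForm T y := by
  have hs : CFC.sqrt T * CFC.sqrt T = T := CFC.sqrt_mul_sqrt_self T hT
  have h0 : (0 : H →L[ℂ] H) ≤ CFC.sqrt T := CFC.sqrt_nonneg T
  have key : ∀ u v : H, inner ℂ u (T v) = inner ℂ (CFC.sqrt T u) (CFC.sqrt T v) := by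
    intro u v
    rw [inner_map_comm_of_nonneg h0, ← mul_apply_eq_comp, hs]
  have hq : ∀ u : H, quadForm T u = ‖CFC.sqrt T u‖ ^ 2 := by
    intro u
    rw [quadForm, key]
    exact inner_self_eq_norm_sq (𝕜 := ℂ) _
  rw [key, hq, hq, ← mul_pow]
  gcongr
  exact norm_inner_le_norm _ _

omit [CompleteSpace H] in
lemma mul_inverse_apply {P : H →L[ℂ] H} (hP : IsStrictlyPositive P) (x : H) :
    P (P⁻¹ʳ x) = x := by
  rw [← mul_apply_eq_comp, Ring.mul_inverse_cancel P hP.isUnit,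
    one_apply_eq_self]

/-- Cauchy–Schwarz for the form of `P`, applied to `P⁻¹ x` and `u`. -/
lemma norm_inner_sq_le_quadForm_inverse_mul {P : H →L[ℂ] H} (hP : IsStrictlyPositive P)
    (x u : H) : ‖inner ℂ x u‖ ^ 2 ≤ quadForm P⁻¹ʳ x * quadForm P u := by
  have h := norm_inner_sq_le_quadForm_mul hP.nonneg (P⁻¹ʳ x) u
  rw [← inner_map_comm_of_nonneg hP.nonneg, mul_inverse_apply hP] at h
  have : quadForm P (P⁻¹ʳ x) = quadForm P⁻¹ʳ x := by
    rw [quadForm, mul_inverse_apply hP, quadForm]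
    exact inner_re_symm (𝕜 := ℂ) _ _
  rwa [this] at h

omit [CompleteSpace H] in
lemma quadForm_conj {S T : H →L[ℂ] H} (hS : 0 ≤ S) (x : H) :
    quadForm (S * T * S) x = quadForm T (S x) := by
  simp only [quadForm, mul_apply_eq_comp]
  rw [inner_map_comm_of_nonneg hS]

lemma inverse_eq_of_mul_eq_one {A : Type*} [Ring A] {a b : A} (h₁ : a * b = 1) (h₂ : b * a = 1) :
    IsUnit a ∧ a⁻¹ʳ = b :=
  ⟨⟨⟨a, b, h₁, h₂⟩, rfl⟩, Ring.inverse_unit ⟨a, b, h₁, h₂⟩⟩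

/-- The Sherman–Morrison formula for a rank-one perturbation of a strictly positive operator. -/
lemma sherman_morrison {P : H →L[ℂ] H} (hP : IsStrictlyPositive P) (v : H) {s : ℝ}
    (hs : 0 < 1 + s * quadForm P⁻¹ʳ v) :
    IsStrictlyPositive (P + s • rankOne ℂ v v) ∧
      (P + s • rankOne ℂ v v)⁻¹ʳ =
        P⁻¹ʳ - (s / (1 + s * quadForm P⁻¹ʳ v)) • rankOne ℂ (P⁻¹ʳ v) (P⁻¹ʳ v) := by
  set R := P⁻¹ʳ with hR
  set a := quadForm R v with ha
  have hR0 : 0 ≤ R := hP.ringInverse.nonneg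
  have hPR : ∀ x, P (R x) = x := mul_inverse_apply hP
  have hRP : ∀ x, R (P x) = x := fun x => by
    rw [← mul_apply_eq_comp, Ring.inverse_mul_cancel P hP.isUnit,
      one_apply_eq_self]
  have hinn : inner ℂ v (R v) = (a : ℂ) := by
    have him : (inner ℂ v (R v)).im = 0 := by
      have := inner_conj_symm (𝕜 := ℂ) v (R v)
      rw [inner_map_comm_of_nonneg hR0] at this
      exact Complex.conj_eq_iff_im.1 this
    apply Complex.ext <;> simp [ha, quadForm, him]
  have hne : (1 + s * a : ℂ) ≠ 0 := by exact_mod_cast hs.ne'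
  have h₁ : (P + s • rankOne ℂ v v) * (R - (s / (1 + s * a)) • rankOne ℂ (R v) (R v)) = 1 := by
    ext x
    simp only [mul_apply_eq_comp, add_apply,
      sub_apply, smul_apply, rankOne_apply, map_sub,
      map_smul, hPR, one_apply_eq_self,
      ContinuousLinearMap.map_smul_of_tower,
      hinn, inner_map_comm_of_nonneg hR0]
    simp only [← Complex.coe_smul, smul_smul]
    match_scalars
    · simp
    · field_simp; ring
  have h₂ : (R - (s / (1 + s * a)) • rankOne ℂ (R v) (R v)) * (P + s • rankOne ℂ v v) = 1 := by
    ext x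
    simp only [mul_apply_eq_comp, add_apply,
      sub_apply, smul_apply, rankOne_apply, map_add,
      map_smul, hRP, one_apply_eq_self,
      ContinuousLinearMap.map_smul_of_tower,
      inner_map_comm_of_nonneg hR0, hinn]
    simp only [← Complex.coe_smul, smul_smul]
    match_scalars
    · simp
    · field_simp; ring
  obtain ⟨hu, hi⟩ := inverse_eq_of_mul_eq_one h₁ h₂
  refine ⟨hu.isStrictlyPositive ?_, hi⟩
  rw [nonneg_iff_quadForm]
  refine ⟨hP.isSelfAdjoint.add ((IsSelfAdjoint.all s).smul
    (rankOne_self_nonneg v).isSelfAdjoint), fun u => ?_⟩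
  rw [quadForm_add, quadForm_smul, quadForm_rankOne]
  -- For `s < 0` this bounds the perturbed form below by `(1 + s ⟪v, P⁻¹ v⟫) ⟪u, P u⟫`.
  have h := norm_inner_sq_le_quadForm_inverse_mul hP v u
  have hPu := quadForm_nonneg hP.nonneg u
  rcases le_total 0 s with h0 | h0
  · positivity
  · nlinarith [mul_le_mul_of_nonpos_left h h0, mul_nonneg hs.le hPu]

omit [CompleteSpace H] in
lemma inverse_sub_inverse {P Q : H →L[ℂ] H} (hP : IsStrictlyPositive P)
    (hQ : IsStrictlyPositive Q) : P⁻¹ʳ - Q⁻¹ʳ = P⁻¹ʳ * (Q - P) * Q⁻¹ʳ := by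
  rw [mul_sub, sub_mul, mul_assoc, Ring.mul_inverse_cancel Q hQ.isUnit, mul_one,
    Ring.inverse_mul_cancel P hP.isUnit, one_mul]

end OperatorForms

/-! ### Frame operators: quadratic form, positivity, compactness. -/

section FrameOperator

open Ring InnerProductSpace

variable {D H : Type*} [MeasurableSpace D] {μ : Measure D} [NormedAddCommGroup H]
  [InnerProductSpace ℂ H]

/-- The frame operator `∫ f(x) f(x)^* dμ(x)` of a square-integrable vector field `f`. -/
noncomputable def frameOp (μ : Measure D) (f : D → H) : H →L[ℂ] H :=
  ∫ x, rankOne ℂ (f x) (f x) ∂μ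

lemma continuous_rankOne_self : Continuous fun v : H => rankOne ℂ v v :=
  (ContinuousLinearMap.smulRightL ℂ H H).continuous₂.comp
    ((innerSL ℂ).continuous.prodMk continuous_id)

variable {f : D → H}

lemma integrable_rankOne (hf : MemLp f 2 μ) : Integrable (fun x => rankOne ℂ (f x) (f x)) μ := by
  refine (hf.integrable_norm_pow (by norm_num)).mono'
    (continuous_rankOne_self.comp_aestronglyMeasurable hf.1) (ae_of_all _ fun x => ?_)
  simp [pow_two]

lemma integrable_quadForm (hf : MemLp f 2 μ) (T : H →L[ℂ] H) :
    Integrable (fun x => quadForm T (f x)) μ := by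
  refine ((hf.integrable_norm_pow (by norm_num)).const_mul ‖T‖).mono'
    ((continuous_quadForm T).comp_aestronglyMeasurable hf.1) (ae_of_all _ fun x => ?_)
  exact abs_quadForm_le T (f x)

lemma integrable_norm_inner_sq (hf : MemLp f 2 μ) (v : H) :
    Integrable (fun x => ‖inner ℂ (f x) v‖ ^ 2) μ := by
  refine ((hf.integrable_norm_pow (by norm_num)).const_mul (‖v‖ ^ 2)).mono'
    (Continuous.comp_aestronglyMeasurable (g := fun y => ‖inner ℂ y v‖ ^ 2) (by fun_prop) hf.1)
    (ae_of_all _ fun x => ?_)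
  rw [Real.norm_of_nonneg (by positivity), mul_comm, ← mul_pow]
  gcongr
  exact norm_inner_le_norm _ _

variable [CompleteSpace H]

lemma inner_frameOp (hf : MemLp f 2 μ) (u v : H) :
    inner ℂ u (frameOp μ f v) = ∫ x, inner ℂ u (f x) * inner ℂ (f x) v ∂μ := by
  have h := ((innerSL ℂ u).comp (ContinuousLinearMap.apply ℂ H v)).integral_comp_comm
    (integrable_rankOne hf)
  simp only [ContinuousLinearMap.comp_apply, ContinuousLinearMap.apply_apply, innerSL_apply_apply,
    rankOne_apply, inner_smul_right] at h
  rw [frameOp, ← h]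
  simp only [mul_comm]

lemma quadForm_frameOp (hf : MemLp f 2 μ) (v : H) :
    quadForm (frameOp μ f) v = ∫ x, ‖inner ℂ (f x) v‖ ^ 2 ∂μ := by
  rw [quadForm, inner_frameOp hf, ← Complex.ofReal_re (∫ x, ‖inner ℂ (f x) v‖ ^ 2 ∂μ),
    ← integral_complex_ofReal]
  congr 2 with x
  rw [← inner_conj_symm v, ← Complex.normSq_eq_conj_mul_self, Complex.normSq_eq_norm_sq]

lemma frameOp_nonneg (hf : MemLp f 2 μ) : 0 ≤ frameOp μ f := by
  rw [nonneg_iff_quadForm]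
  refine ⟨?_, fun v => ?_⟩
  · rw [ContinuousLinearMap.isSelfAdjoint_iff_isSymmetric]
    intro u v
    rw [ContinuousLinearMap.coe_coe, ← inner_conj_symm, inner_frameOp hf, inner_frameOp hf,
      ← integral_conj]
    congr with x
    rw [map_mul, inner_conj_symm, inner_conj_symm, mul_comm]
  · rw [quadForm_frameOp hf]
    positivity

omit [CompleteSpace H] in
lemma isCompactOperator_rankOne (u v : H) : IsCompactOperator (rankOne ℂ u v) := by
  rw [rankOne_def', ContinuousLinearMap.coe_comp]
  exact ((isCompactOperator_of_locallyCompactSpace_rng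
    (ContinuousLinearMap.toSpanSingleton ℂ u)).comp_clm (innerSL ℂ v))

/-- Compact operators form a closed, hence complete, subspace, so the Bochner integral can be taken
inside it. -/
lemma isCompactOperator_frameOp (hf : MemLp f 2 μ) : IsCompactOperator (frameOp μ f) := by
  let C : Submodule ℂ (H →L[ℂ] H) := compactOperator (RingHom.id ℂ) H H
  have hC : IsClosed (C : Set (H →L[ℂ] H)) := isClosed_setOfPred_isCompactOperator
  have : CompleteSpace C := hC.completeSpace_coe
  let g : H → C := fun v => ⟨rankOne ℂ v v, isCompactOperator_rankOne v v⟩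
  have hg : Continuous g := continuous_rankOne_self.subtype_mk _
  have hi : Integrable (fun x => g (f x)) μ :=
    (integrable_rankOne hf).mono (hg.comp_aestronglyMeasurable hf.1) (ae_of_all _ fun x => le_rfl)
  have h : frameOp μ f = C.subtypeL (∫ x, g (f x) ∂μ) := by
    rw [← C.subtypeL.integral_comp_comm hi]
    rfl
  rw [h]
  exact (∫ x, g (f x) ∂μ).2

lemma quadForm_frameOp_le (hf : MemLp f 2 μ) (v : H) :
    quadForm (frameOp μ f) v ≤ (∫ x, ‖f x‖ ^ 2 ∂μ) * ‖v‖ ^ 2 := by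
  rw [quadForm_frameOp hf, ← integral_mul_const]
  refine integral_mono (integrable_norm_inner_sq hf v)
    ((hf.integrable_norm_pow (by norm_num)).mul_const _) fun x => ?_
  simp only [← mul_pow]
  gcongr
  exact norm_inner_le_norm _ _

/-- If the frame operator of `f` is positive definite, then positive definite quadratic forms have
positive integral along `f`. -/
lemma integral_quadForm_pos_of_frameOp [Nontrivial H] (hf : MemLp f 2 μ)
    (hK : ∀ v, v ≠ 0 → 0 < quadForm (frameOp μ f) v) {T : H →L[ℂ] H}
    (hT : ∀ v, v ≠ 0 → 0 < quadForm T v) : 0 < ∫ x, quadForm T (f x) ∂μ := by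
  have hT0 : ∀ v, 0 ≤ quadForm T v := fun v => by
    rcases eq_or_ne v 0 with rfl | hv
    · simp [quadForm]
    · exact (hT v hv).le
  refine (integral_nonneg fun x => hT0 (f x)).lt_of_ne' fun h0 => ?_
  rw [integral_eq_zero_iff_of_nonneg (fun x => hT0 (f x)) (integrable_quadForm hf T)] at h0
  obtain ⟨v, hv⟩ := exists_ne (0 : H)
  have := hK v hv
  rw [quadForm_frameOp hf, integral_eq_zero_of_ae] at this
  · exact this.false
  · filter_upwards [h0] with x hx
    have : f x = 0 := by
      by_contra hne
      exact (hT _ hne).ne' hx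
    simp [this]

end FrameOperator

/-! ### Barrier potentials and single barrier steps. -/

section BarrierSteps

open Ring InnerProductSpace

variable {D H : Type*} [MeasurableSpace D] {μ : Measure D} [NormedAddCommGroup H]
  [InnerProductSpace ℂ H]

/-- The barrier potential `∫ ⟪f(x), P⁻¹ f(x)⟫ dμ(x)`, that is, the trace of `P⁻¹` against the
frame operator of `f`. -/
noncomputable def barrierPotential (μ : Measure D) (f : D → H) (P : H →L[ℂ] H) : ℝ :=
  ∫ x, quadForm P⁻¹ʳ (f x) ∂μ

variable {f : D → H} [CompleteSpace H]

lemma le_iff_quadForm {S T : H →L[ℂ] H} (hS : IsSelfAdjoint S) (hT : IsSelfAdjoint T) :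
    S ≤ T ↔ ∀ x, quadForm S x ≤ quadForm T x := by
  rw [ContinuousLinearMap.le_def, ← ContinuousLinearMap.nonneg_iff_isPositive, nonneg_iff_quadForm]
  simp [hT.sub hS]

/-- Cauchy–Schwarz under the integral. This is `K ≤ Φ(P) P`, the passage from potential bounds to
operator bounds. -/
lemma quadForm_frameOp_le_potential_mul (hf : MemLp f 2 μ) {P : H →L[ℂ] H}
    (hP : IsStrictlyPositive P) (u : H) :
    quadForm (frameOp μ f) u ≤ barrierPotential μ f P * quadForm P u := by
  rw [quadForm_frameOp hf, barrierPotential, ← integral_mul_const]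
  exact integral_mono (integrable_norm_inner_sq hf u) ((integrable_quadForm hf _).mul_const _)
    fun x => norm_inner_sq_le_quadForm_inverse_mul hP _ _

/-- From `K ≤ Φ(P) P`, at least `(1 - δ Φ(P)) P` is left after the shift. -/
lemma isStrictlyPositive_sub_frameOp (hf : MemLp f 2 μ) {P : H →L[ℂ] H}
    (hP : IsStrictlyPositive P) {δ : ℝ} (hδ : 0 ≤ δ) (h : δ * barrierPotential μ f P < 1) :
    IsStrictlyPositive (P - δ • frameOp μ f) := by
  have h1 : IsStrictlyPositive ((1 - δ * barrierPotential μ f P) • P) := hP.smul (by linarith)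
  refine h1.of_le ((le_iff_quadForm h1.isSelfAdjoint (hP.isSelfAdjoint.sub
    ((IsSelfAdjoint.all δ).smul (frameOp_nonneg hf).isSelfAdjoint))).2 fun x => ?_)
  have := mul_le_mul_of_nonneg_left (quadForm_frameOp_le_potential_mul hf hP x) hδ
  simp only [quadForm_sub, quadForm_smul]
  linarith

lemma isStrictlyPositive_add_frameOp (hf : MemLp f 2 μ) {P : H →L[ℂ] H}
    (hP : IsStrictlyPositive P) {δ : ℝ} (hδ : 0 ≤ δ) :
    IsStrictlyPositive (P + δ • frameOp μ f) :=
  hP.add_nonneg (smul_nonneg hδ (frameOp_nonneg hf))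

lemma barrierPotential_add_rankOne (hf : MemLp f 2 μ) {P : H →L[ℂ] H}
    (hP : IsStrictlyPositive P) (v : H) {s : ℝ} (hs : 0 < 1 + s * quadForm P⁻¹ʳ v) :
    barrierPotential μ f (P + s • rankOne ℂ v v) = barrierPotential μ f P -
      s / (1 + s * quadForm P⁻¹ʳ v) * quadForm (frameOp μ f) (P⁻¹ʳ v) := by
  rw [barrierPotential, (sherman_morrison hP v hs).2, quadForm_frameOp hf, ← integral_const_mul,
    barrierPotential, ← integral_sub (integrable_quadForm hf _)
      ((integrable_norm_inner_sq hf _).const_mul _)]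
  congr with x
  rw [quadForm_sub, quadForm_smul, quadForm_rankOne, norm_inner_symm]

section Gap

variable {P K : H →L[ℂ] H} {δ : ℝ}

omit [CompleteSpace H] in
lemma inverse_apply_sub_inverse_add_smul_apply (hP : IsStrictlyPositive P)
    (hQ : IsStrictlyPositive (P + δ • K)) (x : H) :
    P⁻¹ʳ x = (P + δ • K)⁻¹ʳ x + (δ : ℂ) • P⁻¹ʳ (K ((P + δ • K)⁻¹ʳ x)) ∧
    P⁻¹ʳ x = (P + δ • K)⁻¹ʳ x + (δ : ℂ) • (P + δ • K)⁻¹ʳ (K (P⁻¹ʳ x)) := by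
  have h₁ := congrArg (fun T : H →L[ℂ] H => T x) (inverse_sub_inverse hP hQ)
  have h₂ := congrArg (fun T : H →L[ℂ] H => T x) (inverse_sub_inverse hQ hP)
  simp only [add_sub_cancel_left, sub_add_cancel_left, sub_apply, mul_apply_eq_comp, smul_apply,
    neg_apply, ContinuousLinearMap.map_smul_of_tower, map_neg] at h₁ h₂
  simp only [Complex.coe_smul]
  exact ⟨by rw [← h₁]; abel, by rw [← neg_eq_iff_eq_neg.2 h₂]; abel⟩

/-- Expansion of a resolvent around the smaller one. -/
lemma quadForm_inverse_eq_of_add_smul (hP : IsStrictlyPositive P) (hK : 0 ≤ K)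
    (hQ : IsStrictlyPositive (P + δ • K)) (x : H) :
    quadForm P⁻¹ʳ x = quadForm (P + δ • K)⁻¹ʳ x +
      δ * (quadForm K ((P + δ • K)⁻¹ʳ x) + δ * quadForm P⁻¹ʳ (K ((P + δ • K)⁻¹ʳ x))) := by
  have h := inverse_apply_sub_inverse_add_smul_apply hP hQ
  set r := (P + δ • K)⁻¹ʳ
  have hr : 0 ≤ r := hQ.ringInverse.nonneg
  have h₁ : quadForm P⁻¹ʳ x = quadForm r x + δ * (inner ℂ x (r (K (P⁻¹ʳ x)))).re := by
    have e := congrArg (fun z => (inner ℂ x z).re) (h x).2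
    simpa only [quadForm, inner_add_right, inner_smul_right, Complex.add_re,
      Complex.re_ofReal_mul] using e
  rw [h₁, ← inner_map_comm_of_nonneg hr, (h x).1, map_add, map_smul, inner_add_right,
    inner_smul_right, Complex.add_re, Complex.re_ofReal_mul, 
    ← inner_map_comm_of_nonneg hK (r x) (P⁻¹ʳ _)]
  rfl

/-- Expansion of a resolvent around the larger one: the first-order term `g` is given explicitly,
as well as its defect from the quadratic form of `K`. -/
lemma exists_first_order_term (hP : IsStrictlyPositive P) (hK : 0 ≤ K)
    (hQ : IsStrictlyPositive (P + δ • K)) (t : ℝ) (x : H) :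
    ∃ g y : ℝ, quadForm P⁻¹ʳ x - quadForm (P + δ • K)⁻¹ʳ x = δ * g ∧
      quadForm K (P⁻¹ʳ x) - g = δ * y ∧
      0 ≤ t ^ 2 * quadForm (P + δ • K)⁻¹ʳ x - 2 * t * g + y := by
  have h := inverse_apply_sub_inverse_add_smul_apply hP hQ
  set r := (P + δ • K)⁻¹ʳ
  have hr : 0 ≤ r := hQ.ringInverse.nonneg
  have hR : 0 ≤ P⁻¹ʳ := hP.ringInverse.nonneg
  refine ⟨(inner ℂ x (r (K (P⁻¹ʳ x)))).re, quadForm r (K (P⁻¹ʳ x)), ?_, ?_, ?_⟩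
  · have e := congrArg (fun z => (inner ℂ x z).re) (h x).2
    simp only [inner_add_right, inner_smul_right, Complex.add_re, Complex.re_ofReal_mul] at e
    simp only [quadForm, e, add_sub_cancel_left]
  · have h₁ : quadForm K (P⁻¹ʳ x) = (inner ℂ x (P⁻¹ʳ (K (P⁻¹ʳ x)))).re := by
      rw [quadForm, inner_map_comm_of_nonneg hR]
    rw [h₁, (h (K (P⁻¹ʳ x))).1, inner_add_right, inner_smul_right, Complex.add_re,
      Complex.re_ofReal_mul, ← inner_map_comm_of_nonneg hR, ← inner_map_comm_of_nonneg hK]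
    simp [quadForm]
  · have := quadForm_nonneg hr ((t : ℂ) • x - K (P⁻¹ʳ x))
    have hs : (inner ℂ (K (P⁻¹ʳ x)) (r x)).re = (inner ℂ x (r (K (P⁻¹ʳ x)))).re := by
      rw [← inner_map_comm_of_nonneg hr, ← inner_conj_symm, Complex.conj_re]
    simp only [quadForm, map_sub, map_smul, inner_sub_left, inner_sub_right, inner_smul_left,
      inner_smul_right, Complex.sub_re, Complex.conj_ofReal, Complex.re_ofReal_mul, hs] at this ⊢
    linarith

end Gap

omit [CompleteSpace H] in
lemma integrable_quadForm_comp (hf : MemLp f 2 μ) {S : H →L[ℂ] H} (hS : 0 ≤ S) (T : H →L[ℂ] H) :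
    Integrable (fun x => quadForm T (S (f x))) μ := by
  simpa only [quadForm_conj hS] using integrable_quadForm hf (S * T * S)

lemma integral_quadForm_frameOp_inverse_pos [Nontrivial H] (hf : MemLp f 2 μ)
    (hK : ∀ v, v ≠ 0 → 0 < quadForm (frameOp μ f) v) {P : H →L[ℂ] H}
    (hP : IsStrictlyPositive P) :
    0 < ∫ x, quadForm (frameOp μ f) (P⁻¹ʳ (f x)) ∂μ := by
  have hR := hP.ringInverse.nonneg
  simp only [← quadForm_conj hR]
  refine integral_quadForm_pos_of_frameOp hf hK fun v hv => ?_
  rw [quadForm_conj hR]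
  refine hK _ fun h0 => hv ?_
  rw [← mul_inverse_apply hP v, h0, map_zero]

/-- The second-order remainder of the resolvent expansion is nonnegative. This bounds the mean of
`U` in the upper step. -/
lemma mul_integral_le_barrierPotential_sub (hf : MemLp f 2 μ) {P : H →L[ℂ] H}
    (hP : IsStrictlyPositive P) {δ : ℝ} (hδ : 0 ≤ δ) :
    δ * ∫ x, quadForm (frameOp μ f) ((P + δ • frameOp μ f)⁻¹ʳ (f x)) ∂μ ≤
      barrierPotential μ f P - barrierPotential μ f (P + δ • frameOp μ f) := by
  have hK := frameOp_nonneg hf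
  have hQ := isStrictlyPositive_add_frameOp hf hP hδ
  rw [barrierPotential, barrierPotential, ← integral_sub (integrable_quadForm hf _)
    (integrable_quadForm hf _), ← integral_const_mul]
  refine integral_mono ((integrable_quadForm_comp hf hQ.ringInverse.nonneg _).const_mul _)
    ((integrable_quadForm hf _).sub (integrable_quadForm hf _)) fun x => ?_
  simp only
  rw [quadForm_inverse_eq_of_add_smul hP hK hQ]
  have := quadForm_nonneg hP.ringInverse.nonneg (frameOp μ f ((P + δ • frameOp μ f)⁻¹ʳ (f x)))
  nlinarith [mul_nonneg (mul_nonneg hδ hδ) this]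

omit [NormedAddCommGroup H] [InnerProductSpace ℂ H] [CompleteSpace H] in
lemma integral_combination_nonneg {a b c : D → ℝ} (ha : Integrable a μ) (hb : Integrable b μ)
    (hc : Integrable c μ) {α β γ : ℝ} (h : ∀ x, 0 ≤ α * a x + β * b x + γ * c x) :
    0 ≤ α * ∫ x, a x ∂μ + β * ∫ x, b x ∂μ + γ * ∫ x, c x ∂μ := by
  rw [← integral_const_mul, ← integral_const_mul, ← integral_const_mul,
    ← integral_add (ha.const_mul α) (hb.const_mul β),
    ← integral_add (f := fun x => α * a x + β * b x) ((ha.const_mul α).add (hb.const_mul β))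
      (hc.const_mul γ)]
  exact integral_nonneg_of_ae (ae_of_all _ h)

/-- A reverse estimate with a quadratic gain, which bounds the mean of `L` from below in the lower
step. It comes from completing a square pointwise. -/
lemma barrierPotential_sub_le_mul_integral (hf : MemLp f 2 μ) {P : H →L[ℂ] H}
    (hP : IsStrictlyPositive P) {δ : ℝ} (hδ : 0 < δ)
    (hQ1 : δ * barrierPotential μ f (P + δ • frameOp μ f) ≤ 1) :
    (barrierPotential μ f P - barrierPotential μ f (P + δ • frameOp μ f)) *
      (1 / δ + (barrierPotential μ f P - barrierPotential μ f (P + δ • frameOp μ f))) ≤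
      ∫ x, quadForm (frameOp μ f) (P⁻¹ʳ (f x)) ∂μ := by
  have hK := frameOp_nonneg hf
  have hQ := isStrictlyPositive_add_frameOp hf hP hδ.le
  set S := barrierPotential μ f P - barrierPotential μ f (P + δ • frameOp μ f) with hS
  -- With `Q = P + δK`, this is `δ²` times the `Q⁻¹`-form at `S f(x) - K P⁻¹ f(x)`. Its integral is
  -- `δT - S - 2δS² + δ²S² Φ(Q)`, and `δ Φ(Q) ≤ 1` absorbs one `δS²`.
  have hpt : ∀ x, 0 ≤ (S ^ 2 * δ ^ 2 + 2 * S * δ + 1) * quadForm (P + δ • frameOp μ f)⁻¹ʳ (f x)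
      + -(2 * S * δ + 1) * quadForm P⁻¹ʳ (f x)
      + δ * quadForm (frameOp μ f) (P⁻¹ʳ (f x)) := by
    intro x
    obtain ⟨g, y, h₁, h₂, h₃⟩ := exists_first_order_term hP hK hQ S (f x)
    have e₁ := sub_eq_iff_eq_add.1 h₁
    have e₂ := sub_eq_iff_eq_add.1 h₂
    rw [e₁, e₂]
    nlinarith [mul_nonneg (sq_nonneg δ) h₃]
  have hint := integral_combination_nonneg (integrable_quadForm hf _) (integrable_quadForm hf _)
    (integrable_quadForm_comp hf hP.ringInverse.nonneg _) hpt
  change 0 ≤ _ * barrierPotential μ f (P + δ • frameOp μ f) +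
    _ * barrierPotential μ f P + _ at hint
  set T := ∫ x, quadForm (frameOp μ f) (P⁻¹ʳ (f x)) ∂μ
  set Φ := barrierPotential μ f (P + δ • frameOp μ f)
  have hΦ : barrierPotential μ f P = S + Φ := by rw [hS]; ring
  rw [hΦ] at hint
  clear_value S T Φ
  have key : 0 ≤ δ * (T - S * (1 / δ + S)) := by
    have e : δ * (T - S * (1 / δ + S)) = δ * T - S - δ * S ^ 2 := by field_simp; ring
    rw [e]
    nlinarith [mul_le_mul_of_nonneg_left hQ1 (mul_nonneg (sq_nonneg S) hδ.le)]
  linarith [nonneg_of_mul_nonneg_right key hδ]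

/-- One step of the upper barrier argument: the barrier moves up by `δ` times the frame operator
and any sample with weight `w ≤ 1 / U x` can be accommodated. -/
lemma exists_upper_barrier_step [Nontrivial H] (hf : MemLp f 2 μ)
    (hK : ∀ v, v ≠ 0 → 0 < quadForm (frameOp μ f) v) {P : H →L[ℂ] H}
    (hP : IsStrictlyPositive P) {δ : ℝ} (hδ : 0 < δ) :
    ∃ U : D → ℝ, Integrable U μ ∧ (∀ x, 0 ≤ U x) ∧
      ∫ x, U x ∂μ ≤ 1 / δ + barrierPotential μ f P ∧
      ∀ x w, 0 < w → w * U x ≤ 1 →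
        IsStrictlyPositive (P + δ • frameOp μ f - w • rankOne ℂ (f x) (f x)) ∧
        barrierPotential μ f (P + δ • frameOp μ f - w • rankOne ℂ (f x) (f x)) ≤
          barrierPotential μ f P := by
  have hQ := isStrictlyPositive_add_frameOp hf hP hδ.le
  have hgap := mul_integral_le_barrierPotential_sub hf hP hδ.le
  have hT := integral_quadForm_frameOp_inverse_pos hf hK hQ
  set Q := P + δ • frameOp μ f
  set S := barrierPotential μ f P - barrierPotential μ f Q with hSdef
  have hS : 0 < S := lt_of_lt_of_le (mul_pos hδ hT) hgap
  have hr := hQ.ringInverse.nonneg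
  have hK0 := frameOp_nonneg hf
  -- By Sherman–Morrison the sample raises `Φ(Q)` by `w c / (1 - w a)`. Requiring this to be at most
  -- `S` is `w (c / S + a) ≤ 1`.
  refine ⟨fun x => quadForm (frameOp μ f) (Q⁻¹ʳ (f x)) / S + quadForm Q⁻¹ʳ (f x),
    ((integrable_quadForm_comp hf hr _).div_const S).add (integrable_quadForm hf _), fun x =>
    add_nonneg (div_nonneg (quadForm_nonneg hK0 _) hS.le) (quadForm_nonneg hr _), ?_, ?_⟩
  · rw [integral_add ((integrable_quadForm_comp hf hr _).div_const S) (integrable_quadForm hf _),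
      integral_div]
    change _ + barrierPotential μ f Q ≤ _
    have h₁ : (∫ x, quadForm (frameOp μ f) (Q⁻¹ʳ (f x)) ∂μ) / S ≤ 1 / δ := by
      rw [div_le_div_iff₀ hS hδ]
      linarith
    linarith
  · intro x w hw hwU
    set c := quadForm (frameOp μ f) (Q⁻¹ʳ (f x)) with hc
    set a := quadForm Q⁻¹ʳ (f x) with ha
    have hwS : w * c + w * a * S ≤ S := by
      have := mul_le_mul_of_nonneg_right hwU hS.le
      rw [one_mul, mul_add, add_mul, mul_div_assoc', div_mul_cancel₀ _ hS.ne'] at this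
      exact this
    -- Strictness comes from `c > 0`, that is, from definiteness of `K`; where `f x = 0` also `a =
    -- 0`.
    have ha1 : 0 < 1 + -w * a := by
      rcases eq_or_ne (f x) 0 with h0 | h0
      · simp [ha, h0, quadForm]
      · have : 0 < c := hK _ fun h => h0 (by rw [← mul_inverse_apply hQ (f x), h, map_zero])
        have : w * a * S < 1 * S := by nlinarith [mul_pos hw this]
        have := lt_of_mul_lt_mul_right this hS.le
        linarith
    rw [sub_eq_add_neg, ← neg_smul]
    refine ⟨(sherman_morrison hQ (f x) ha1).1, ?_⟩
    rw [barrierPotential_add_rankOne hf hQ (f x) ha1]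
    have : -w / (1 + -w * a) * c = -(w * c / (1 + -w * a)) := by ring
    rw [this]
    have : w * c / (1 + -w * a) ≤ S := by
      rw [div_le_iff₀ ha1]
      nlinarith
    linarith

/-- One step of the lower barrier argument: the barrier moves up by `δ` times the frame operator,
provided that a sample with weight `w ≥ 1 / L x` is added. -/
lemma exists_lower_barrier_step [Nontrivial H] (hf : MemLp f 2 μ)
    (hK : ∀ v, v ≠ 0 → 0 < quadForm (frameOp μ f) v) {P : H →L[ℂ] H}
    (hP : IsStrictlyPositive P) {δ : ℝ} (hδ : 0 < δ) (h1 : δ * barrierPotential μ f P < 1) :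
    ∃ L : D → ℝ, Integrable L μ ∧ 1 / δ - barrierPotential μ f P ≤ ∫ x, L x ∂μ ∧
      ∀ x w, 0 < w → 1 ≤ w * L x →
        IsStrictlyPositive (P - δ • frameOp μ f + w • rankOne ℂ (f x) (f x)) ∧
        barrierPotential μ f (P - δ • frameOp μ f + w • rankOne ℂ (f x) (f x)) ≤
          barrierPotential μ f P := by
  have hQ := isStrictlyPositive_sub_frameOp hf hP hδ.le h1
  have hK0 := frameOp_nonneg hf
  set Q := P - δ • frameOp μ f with hQdef
  have hPQ : P = Q + δ • frameOp μ f := by simp [hQdef]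
  -- The smaller operator is now `Q`, so both resolvent estimates are applied with `Q` as base point
  -- and `P = Q + δK`.
  have hgap : δ * ∫ x, quadForm (frameOp μ f) (P⁻¹ʳ (f x)) ∂μ ≤
      barrierPotential μ f Q - barrierPotential μ f P := by
    rw [hPQ]
    exact mul_integral_le_barrierPotential_sub hf hQ hδ.le
  have hT := integral_quadForm_frameOp_inverse_pos hf hK hP
  have hmain : (barrierPotential μ f Q - barrierPotential μ f P) *
      (1 / δ + (barrierPotential μ f Q - barrierPotential μ f P)) ≤
      ∫ x, quadForm (frameOp μ f) (Q⁻¹ʳ (f x)) ∂μ := by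
    rw [hPQ] at h1 ⊢
    exact barrierPotential_sub_le_mul_integral hf hQ hδ h1.le
  set S := barrierPotential μ f Q - barrierPotential μ f P with hSdef
  have hS : 0 < S := lt_of_lt_of_le (mul_pos hδ hT) hgap
  have hr := hQ.ringInverse.nonneg
  -- The sample must lower `Φ(Q)` by at least `S`: `w c / (1 + w a) ≥ S`, that is, `w (c / S - a) ≥
  -- 1`.
  refine ⟨fun x => quadForm (frameOp μ f) (Q⁻¹ʳ (f x)) / S - quadForm Q⁻¹ʳ (f x),
    ((integrable_quadForm_comp hf hr _).div_const S).sub (integrable_quadForm hf _), ?_, ?_⟩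
  · rw [integral_sub ((integrable_quadForm_comp hf hr _).div_const S) (integrable_quadForm hf _),
      integral_div]
    change _ ≤ _ - barrierPotential μ f Q
    have h₁ : 1 / δ + S ≤ (∫ x, quadForm (frameOp μ f) (Q⁻¹ʳ (f x)) ∂μ) / S := by
      rw [le_div_iff₀ hS]
      linarith
    linarith
  · intro x w hw hwL
    set c := quadForm (frameOp μ f) (Q⁻¹ʳ (f x)) with hc
    set a := quadForm Q⁻¹ʳ (f x) with ha
    have hwS : S ≤ w * c - w * a * S := by
      change 1 ≤ w * (c / S - a) at hwL
      clear_value S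
      have := mul_le_mul_of_nonneg_right hwL hS.le
      rw [one_mul, mul_sub, sub_mul, mul_div_assoc', div_mul_cancel₀ _ hS.ne'] at this
      exact this
    have ha1 : 0 < 1 + w * a := by
      have := quadForm_nonneg hr (f x)
      positivity
    refine ⟨(sherman_morrison hQ (f x) ha1).1, ?_⟩
    rw [barrierPotential_add_rankOne hf hQ (f x) ha1]
    have : S ≤ w / (1 + w * a) * c := by
      rw [div_mul_eq_mul_div, le_div_iff₀ ha1]
      linarith
    linarith

end BarrierSteps

/-! ### Selection of points and weights. -/

section Sampling

variable {D : Type*} [MeasurableSpace D] {μ : Measure D}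

/-- Otherwise `L ≤ U` almost everywhere, so the integrals force `L = U`; but then `L ≤ 0` almost
everywhere, against `∫ L ≥ 1`. -/
lemma exists_le_of_integral_le_one {U L : D → ℝ} (hU : Integrable U μ) (hL : Integrable L μ)
    (hU0 : ∀ x, 0 ≤ U x) (hU1 : ∫ x, U x ∂μ ≤ 1) (hL1 : 1 ≤ ∫ x, L x ∂μ) {p : D → Prop}
    (hp : ∀ᵐ x ∂μ, p x) : ∃ x, p x ∧ U x ≤ L x ∧ 0 < L x := by
  by_contra! hcon
  have hle : L ≤ᵐ[μ] U := by
    filter_upwards [hp] with x hx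
    by_contra! hlt
    exact ((hU0 x).trans_lt hlt).not_ge (hcon x hx hlt.le)
  have heq : L =ᵐ[μ] U := (integral_eq_iff_of_ae_le hL hU hle).1
    (le_antisymm (integral_mono_ae hL hU hle) (hU1.trans hL1))
  have hL0 : L ≤ᵐ[μ] 0 := by
    filter_upwards [hp, heq] with x hx hxe
    exact hcon x hx hxe.ge
  linarith [integral_nonpos_of_ae hL0]

/-- Greedy simultaneous selection of sample points for a lower and an upper invariant. -/
theorem exists_weighted_sample {M₁ M₂ : Type*} [AddCommGroup M₁] [Module ℝ M₁]
    [AddCommGroup M₂] [Module ℝ M₂] (α : D → M₁) (β : D → M₂) {p : D → Prop}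
    (hp : ∀ᵐ x ∂μ, p x) {PL : ℕ → M₁ → Prop} {PU : ℕ → M₂ → Prop} (hPL : PL 0 0) (hPU : PU 0 0)
    (hL : ∀ k A, PL k A → ∃ L : D → ℝ, Integrable L μ ∧ 1 ≤ ∫ x, L x ∂μ ∧
      ∀ x w, 0 < w → 1 ≤ w * L x → PL (k + 1) (A + w • α x))
    (hU : ∀ k B, PU k B → ∃ U : D → ℝ, Integrable U μ ∧ (∀ x, 0 ≤ U x) ∧ ∫ x, U x ∂μ ≤ 1 ∧
      ∀ x w, 0 < w → w * U x ≤ 1 → PU (k + 1) (B + w • β x)) (n : ℕ) :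
    ∃ (x : Fin n → D) (w : Fin n → ℝ), (∀ i, p (x i)) ∧ (∀ i, 0 < w i) ∧
      PL n (∑ i, w i • α (x i)) ∧ PU n (∑ i, w i • β (x i)) := by
  induction n with
  | zero => exact ⟨Fin.elim0, Fin.elim0, fun i => i.elim0, fun i => i.elim0, by simpa, by simpa⟩
  | succ n ih =>
    obtain ⟨x, w, hx, hw, h₁, h₂⟩ := ih
    obtain ⟨L, hLi, hL1, hLs⟩ := hL n _ h₁
    obtain ⟨U, hUi, hU0, hU1, hUs⟩ := hU n _ h₂
    obtain ⟨y, hy, hyU, hyL⟩ := exists_le_of_integral_le_one hUi hLi hU0 hU1 hL1 hp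
    -- The weight `1 / L y` meets the lower condition with equality, and the upper one because `U y
    -- ≤ L y`.
    refine ⟨Fin.snoc (α := fun _ => D) x y, Fin.snoc (α := fun _ => ℝ) w (L y)⁻¹, ?_, ?_, ?_, ?_⟩
    · refine Fin.lastCases ?_ fun i => ?_ <;> simp [hy, hx]
    · refine Fin.lastCases ?_ fun i => ?_ <;> simp [hyL, hw]
    · simpa [Fin.sum_univ_castSucc] using
        hLs y (L y)⁻¹ (inv_pos.2 hyL) (inv_mul_cancel₀ hyL.ne').ge
    · simpa [Fin.sum_univ_castSucc] using
        hUs y (L y)⁻¹ (inv_pos.2 hyL) ((inv_mul_le_one₀ hyL).2 hyU)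

end Sampling

/-! ### Choice of constants for both barriers. -/

section Invariants

open Ring InnerProductSpace

variable {D H : Type*} [MeasurableSpace D] {μ : Measure D} [NormedAddCommGroup H]
  [InnerProductSpace ℂ H] [CompleteSpace H] {f : D → H}

lemma isStrictlyPositive_frameOp [FiniteDimensional ℂ H] (hf : MemLp f 2 μ)
    (hK : ∀ v, v ≠ 0 → 0 < quadForm (frameOp μ f) v) : IsStrictlyPositive (frameOp μ f) := by
  refine IsUnit.isStrictlyPositive ?_ (frameOp_nonneg hf)
  have hinj : Function.Injective (frameOp μ f : H →ₗ[ℂ] H) := by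
    rw [← LinearMap.ker_eq_bot, LinearMap.ker_eq_bot']
    intro v hv
    by_contra hne
    have := hK v hne
    rw [ContinuousLinearMap.coe_coe] at hv
    simp [quadForm, hv] at this
  rw [ContinuousLinearMap.isUnit_iff_bijective]
  exact ⟨hinj, LinearMap.injective_iff_surjective.1 hinj⟩

/-- The trace of `K⁻¹ K`, computed in an orthonormal basis. -/
lemma barrierPotential_frameOp [FiniteDimensional ℂ H] (hf : MemLp f 2 μ)
    (hK : ∀ v, v ≠ 0 → 0 < quadForm (frameOp μ f) v) :
    barrierPotential μ f (frameOp μ f) = Module.finrank ℂ H := by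
  have hP := isStrictlyPositive_frameOp hf hK
  have hR := hP.ringInverse.nonneg
  let b := stdOrthonormalBasis ℂ H
  have hpt : ∀ v, quadForm (frameOp μ f)⁻¹ʳ v =
      ∑ i, (inner ℂ ((frameOp μ f)⁻¹ʳ (b i)) v * inner ℂ v (b i)).re := by
    intro v
    rw [quadForm, ← b.sum_inner_mul_inner, Complex.re_sum]
    refine Finset.sum_congr rfl fun i _ => ?_
    rw [inner_map_comm_of_nonneg hR, mul_comm]
  have hint : ∀ i, Integrable
      (fun x => inner ℂ ((frameOp μ f)⁻¹ʳ (b i)) (f x) * inner ℂ (f x) (b i)) μ := fun i =>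
    ((hf.const_inner (𝕜 := ℂ) ((frameOp μ f)⁻¹ʳ (b i))).integrable_mul (hf.inner_const (b i)))
  rw [barrierPotential]
  simp only [hpt]
  rw [integral_finsetSum (f := fun i x => (inner ℂ ((frameOp μ f)⁻¹ʳ (b i)) (f x) *
    inner ℂ (f x) (b i)).re) _ fun i _ => (hint i).re]
  have : ∀ i, ∫ x, (inner ℂ ((frameOp μ f)⁻¹ʳ (b i)) (f x) * inner ℂ (f x) (b i)).re ∂μ = 1 := by
    intro i
    have h := integral_re (hint i)
    simp only [RCLike.re_to_complex] at h
    rw [h, ← inner_frameOp hf, ← inner_map_comm_of_nonneg hP.nonneg, mul_inverse_apply hP]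
    simp
  rw [Finset.sum_congr rfl fun i _ => this i]
  simp

omit [CompleteSpace H] in
lemma barrierPotential_smul {P : H →L[ℂ] H} (hP : IsStrictlyPositive P) {c : ℝ} (hc : c ≠ 0) :
    barrierPotential μ f (c • P) = c⁻¹ * barrierPotential μ f P := by
  have h : (c • P)⁻¹ʳ = c⁻¹ • P⁻¹ʳ := by
    refine (inverse_eq_of_mul_eq_one ?_ ?_).2 <;>
      simp [hc, Ring.mul_inverse_cancel P hP.isUnit, Ring.inverse_mul_cancel P hP.isUnit]
  simp only [barrierPotential, h, quadForm_smul, integral_const_mul]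

lemma barrierPotential_smul_one {c : ℝ} (hc : c ≠ 0) :
    barrierPotential μ f (c • (1 : H →L[ℂ] H)) = c⁻¹ * ∫ x, ‖f x‖ ^ 2 ∂μ := by
  rw [barrierPotential_smul isStrictlyPositive_one hc]
  simp [barrierPotential]

/-- The lower invariant is a property of the accumulated frame operators that can be maintained
for `n` steps and then yields the lower frame bound. -/
theorem exists_lower_invariant [FiniteDimensional ℂ H] [Nontrivial H] (hf : MemLp f 2 μ)
    (hK : ∀ v, v ≠ 0 → 0 < quadForm (frameOp μ f) v) {n : ℕ} (hn : Module.finrank ℂ H ≤ n) :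
    ∃ PL : ℕ → (H →L[ℂ] H) → Prop, PL 0 0 ∧
      (∀ k A, PL k A → ∃ L : D → ℝ, Integrable L μ ∧ 1 ≤ ∫ x, L x ∂μ ∧
        ∀ x w, 0 < w → 1 ≤ w * L x → PL (k + 1) (A + w • rankOne ℂ (f x) (f x))) ∧
      ∀ A, PL n A → ∀ v, n * (1 - √(((Module.finrank ℂ H : ℝ) - 1) / n)) ^ 2 *
        quadForm (frameOp μ f) v ≤ quadForm A v := by
  have hm : 0 < Module.finrank ℂ H := Module.finrank_pos
  rcases (Nat.succ_le_of_lt hm).eq_or_lt with h1 | h2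
  -- Here `√(m - 1) = 0`, by which the general starting constant divides. In dimension one
  -- Cauchy–Schwarz is an equality, so no barrier is needed.
  · replace h1 : Module.finrank ℂ H = 1 := h1.symm
    obtain ⟨e, he, hspan⟩ := finrank_eq_one_iff'.1 h1
    have hinner : ∀ u v : H, ‖inner ℂ u v‖ ^ 2 = ‖u‖ ^ 2 * ‖v‖ ^ 2 := by
      intro u v
      obtain ⟨c, rfl⟩ := hspan u
      obtain ⟨d, rfl⟩ := hspan v
      simp only [inner_smul_left, inner_smul_right, norm_mul, norm_smul, RCLike.norm_conj,
        inner_self_eq_norm_sq_to_K, norm_pow, Complex.norm_real, norm_norm, Complex.coe_algebraMap]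
      ring
    have hs : 0 < ∫ x, ‖f x‖ ^ 2 ∂μ := by
      have := integral_quadForm_pos_of_frameOp hf hK (T := 1) fun v hv => by
        simpa using pow_pos (norm_pos_iff.2 hv) 2
      simpa using this
    refine ⟨fun k A => ∀ v, k * quadForm (frameOp μ f) v ≤ quadForm A v, by simp, ?_, ?_⟩
    · intro k A hA
      refine ⟨fun x => ‖f x‖ ^ 2 / ∫ x, ‖f x‖ ^ 2 ∂μ,
        (hf.integrable_norm_pow (by norm_num)).div_const _, ?_, ?_⟩
      · rw [integral_div, div_self hs.ne']
      · intro x w hw hwL v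
        rw [mul_div_assoc', le_div_iff₀ hs, one_mul] at hwL
        have h₁ := quadForm_frameOp_le hf v
        have h₂ := mul_le_mul_of_nonneg_right hwL (sq_nonneg ‖v‖)
        have h₃ := hA v
        simp only [quadForm_add, quadForm_smul, quadForm_rankOne, hinner]
        push_cast
        linarith
    · intro A hA v
      simpa [h1] using hA v
  · have hn1 : (Module.finrank ℂ H : ℝ) ≤ n := by exact_mod_cast hn
    have hm1 : (1 : ℝ) < Module.finrank ℂ H := by exact_mod_cast h2
    set m : ℝ := ((Module.finrank ℂ H : ℕ) : ℝ) with hmdef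
    obtain ⟨s, hs0, hs⟩ : ∃ s : ℝ, 0 < s ∧ s ^ 2 = m - 1 :=
      ⟨√(m - 1), Real.sqrt_pos.2 (by linarith), Real.sq_sqrt (by linarith)⟩
    obtain ⟨r, hr0, hr⟩ : ∃ r : ℝ, 0 < r ∧ r ^ 2 = n :=
      ⟨√n, Real.sqrt_pos.2 (by linarith), Real.sq_sqrt (by linarith)⟩
    have hsr : s < r := lt_of_pow_lt_pow_left₀ 2 hr0.le (by linarith)
    have hrs : 0 < r - s := by linarith
    have hsqrt : √((m - 1) / n) = s / r := by
      rw [← hs, ← hr, ← div_pow, Real.sqrt_sq (by positivity)]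
    have hKs := isStrictlyPositive_frameOp hf hK
    have hmpos : 0 < m := by linarith
    -- With `δ = (r - s) / r` and potential at most `s / (r - s)`, the mean of `L` is at least `1 /
    -- δ - s / (r - s) = 1`. The initial multiple of `K` makes the starting potential exactly `s /
    -- (r - s)`.
    refine ⟨fun k A => IsStrictlyPositive
        (A + (m * (r - s) / s - k * ((r - s) / r)) • frameOp μ f) ∧
      barrierPotential μ f (A + (m * (r - s) / s - k * ((r - s) / r)) • frameOp μ f)
        ≤ s / (r - s), ?_, ?_, ?_⟩
    · have hc : 0 < m * (r - s) / s := by positivity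
      simp only [Nat.cast_zero, zero_mul, sub_zero, zero_add]
      refine ⟨hKs.smul hc, ?_⟩
      rw [barrierPotential_smul hKs hc.ne', barrierPotential_frameOp hf hK, ← hmdef]
      apply le_of_eq
      field_simp
    · rintro k A ⟨hP, hΦ⟩
      have hδ : 0 < (r - s) / r := by positivity
      have hδ1 : (r - s) / r * barrierPotential μ f
          (A + (m * (r - s) / s - k * ((r - s) / r)) • frameOp μ f) < 1 := by
        refine (mul_le_mul_of_nonneg_left hΦ hδ.le).trans_lt ?_
        rw [div_mul_div_comm, div_lt_one (by positivity)]
        nlinarith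
      obtain ⟨L, hLi, hL1, hLs⟩ := exists_lower_barrier_step hf hK hP hδ hδ1
      refine ⟨L, hLi, le_trans ?_ hL1, fun x w hw hwL => ?_⟩
      · have : 1 / ((r - s) / r) - s / (r - s) = 1 := by field_simp
        linarith
      · have h := hLs x w hw hwL
        have e : A + w • rankOne ℂ (f x) (f x) +
            (m * (r - s) / s - (k + 1 : ℕ) * ((r - s) / r)) • frameOp μ f =
            A + (m * (r - s) / s - k * ((r - s) / r)) • frameOp μ f -
              ((r - s) / r) • frameOp μ f + w • rankOne ℂ (f x) (f x) := by
          push_cast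
          module
        beta_reduce
        rw [e]
        exact ⟨h.1, h.2.trans hΦ⟩
    · rintro A ⟨hP, hΦ⟩ v
      -- The final slack is at least `((r - s) / s) K`. Thus `A` dominates `(r (r - s) - (m - 1)(r -
      -- s) / s) K = (r - s)² K`.
      have h₁ := (quadForm_frameOp_le_potential_mul hf hP v).trans
        (mul_le_mul_of_nonneg_right hΦ (quadForm_nonneg hP.nonneg v))
      rw [quadForm_add, quadForm_smul] at h₁
      rw [hsqrt]
      have hm' : m = s ^ 2 + 1 := by linarith
      rw [← hr, hm', div_mul_eq_mul_div, le_div_iff₀ hrs] at h₁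
      rw [← hr]
      have e : r ^ 2 * (1 - s / r) ^ 2 * quadForm (frameOp μ f) v =
        (r - s) ^ 2 * quadForm (frameOp μ f) v := by field_simp
      have e₂ : s * (quadForm A v + ((s ^ 2 + 1) * (r - s) / s - r ^ 2 * ((r - s) / r)) *
          quadForm (frameOp μ f) v) = s * quadForm A v +
          ((s ^ 2 + 1) * (r - s) - s * r * (r - s)) * quadForm (frameOp μ f) v := by
        field_simp
      rw [e₂] at h₁
      rw [e]
      refine le_of_mul_le_mul_left ?_ hs0
      linarith

/-- The upper invariant is a property of the accumulated frame operators that can be maintained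
for `n` steps and then yields the upper frame bound. -/
theorem exists_upper_invariant [Nontrivial H] (hf : MemLp f 2 μ)
    (hK : ∀ v, v ≠ 0 → 0 < quadForm (frameOp μ f) v) {l : ℝ} (hl : 0 < l)
    (hKl : ∀ v, quadForm (frameOp μ f) v ≤ l * ‖v‖ ^ 2) {n : ℕ} (hn : 1 ≤ n) :
    ∃ PU : ℕ → (H →L[ℂ] H) → Prop, PU 0 0 ∧
      (∀ k B, PU k B → ∃ U : D → ℝ, Integrable U μ ∧ (∀ x, 0 ≤ U x) ∧ ∫ x, U x ∂μ ≤ 1 ∧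
        ∀ x w, 0 < w → w * U x ≤ 1 → PU (k + 1) (B + w • rankOne ℂ (f x) (f x))) ∧
      ∀ B, PU n B → ∀ v, quadForm B v ≤
        n * ((1 + √(((∫ x, ‖f x‖ ^ 2 ∂μ) / l - 1) / n)) ^ 2 * l) * ‖v‖ ^ 2 := by
  have hT : 0 < ∫ x, ‖f x‖ ^ 2 ∂μ := by
    have := integral_quadForm_pos_of_frameOp hf hK (T := 1) fun v hv => by
        simpa using pow_pos (norm_pos_iff.2 hv) 2
    simpa using this
  set T := ∫ x, ‖f x‖ ^ 2 ∂μ with hTdef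
  have hn0 : (0 : ℝ) < n := by exact_mod_cast hn
  rcases le_or_gt (n * (T / l - 1)) 1 with hsmall | hlarge
  -- For `t = T / l - 1` with `n t ≤ 1` the trace bound suffices: `t ≤ √(t / n)` if `t ≥ 0`, and `1
  -- + t ≤ 1` otherwise.
  · refine ⟨fun k B => ∀ v, quadForm B v ≤ k * T * ‖v‖ ^ 2, by simp, ?_, ?_⟩
    · intro k B hB
      refine ⟨fun x => ‖f x‖ ^ 2 / T, (hf.integrable_norm_pow (by norm_num)).div_const _,
        fun x => by positivity, ?_, ?_⟩
      · rw [integral_div, div_self hT.ne']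
      · intro x w hw hwU v
        rw [mul_div_assoc', div_le_iff₀ hT, one_mul] at hwU
        have h₁ : ‖inner ℂ (f x) v‖ ^ 2 ≤ ‖f x‖ ^ 2 * ‖v‖ ^ 2 := by
          rw [← mul_pow]
          gcongr
          exact norm_inner_le_norm _ _
        have h₂ := mul_le_mul_of_nonneg_right hwU (sq_nonneg ‖v‖)
        have h₃ := mul_le_mul_of_nonneg_left h₁ hw.le
        have h₄ := hB v
        simp only [quadForm_add, quadForm_smul, quadForm_rankOne]
        push_cast
        linarith
    · intro B hB v
      refine (hB v).trans (mul_le_mul_of_nonneg_right ?_ (sq_nonneg _))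
      refine mul_le_mul_of_nonneg_left ?_ hn0.le
      rw [← div_le_iff₀ hl]
      set t := T / l - 1 with ht
      have hTl : T / l = 1 + t := by rw [ht]; ring
      rw [hTl]
      have hq := Real.sqrt_nonneg (t / n)
      rcases le_total t 0 with h0 | h0
      · nlinarith
      · have hle : t ≤ √(t / n) := by
          apply Real.le_sqrt_of_sq_le
          rw [le_div_iff₀ hn0]
          nlinarith
        nlinarith
  · have ht0 : 0 < T / l - 1 := pos_of_mul_pos_right (one_pos.trans hlarge) hn0.le
    obtain ⟨s, hs0, hs⟩ : ∃ s : ℝ, 0 < s ∧ s ^ 2 = T / l - 1 :=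
      ⟨√(T / l - 1), Real.sqrt_pos.2 ht0, Real.sq_sqrt ht0.le⟩
    obtain ⟨r, hr0, hr⟩ : ∃ r : ℝ, 0 < r ∧ r ^ 2 = n :=
      ⟨√n, Real.sqrt_pos.2 hn0, Real.sq_sqrt hn0.le⟩
    have hsqrt : √((T / l - 1) / n) = s / r := by
      rw [← hs, ← hr, ← div_pow, Real.sqrt_sq (by positivity)]
    have hrs1 : 1 ≤ r * s := by
      rw [← hs, ← hr, ← mul_pow] at hlarge
      exact (one_le_sq_iff₀ (by positivity)).1 hlarge.le
    -- The constants are balanced so that `1 / δ + s / (r + s) = 1`, and the multiple of the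
    -- identity gives starting potential `s / (r + s)`.
    refine ⟨fun k B => IsStrictlyPositive
        ((T * (r + s) / s) • (1 : H →L[ℂ] H) + (k * ((r + s) / r)) • frameOp μ f - B) ∧
      barrierPotential μ f
        ((T * (r + s) / s) • (1 : H →L[ℂ] H) + (k * ((r + s) / r)) • frameOp μ f - B)
        ≤ s / (r + s), ?_, ?_, ?_⟩
    · have hc : 0 < T * (r + s) / s := by positivity
      simp only [Nat.cast_zero, zero_mul, zero_smul, sub_zero, add_zero]
      refine ⟨isStrictlyPositive_one.smul hc, ?_⟩
      rw [barrierPotential_smul_one hc.ne', ← hTdef]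
      apply le_of_eq
      field_simp
    · rintro k B ⟨hP, hΦ⟩
      have hδ : 0 < (r + s) / r := by positivity
      obtain ⟨U, hUi, hU0, hU1, hUs⟩ := exists_upper_barrier_step hf hK hP hδ
      refine ⟨U, hUi, hU0, hU1.trans ?_, fun x w hw hwU => ?_⟩
      · have : 1 / ((r + s) / r) + s / (r + s) = 1 := by field_simp
        linarith
      · have h := hUs x w hw hwU
        have e : (T * (r + s) / s) • (1 : H →L[ℂ] H) +
            ((k + 1 : ℕ) * ((r + s) / r)) • frameOp μ f - (B + w • rankOne ℂ (f x) (f x)) =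
            (T * (r + s) / s) • (1 : H →L[ℂ] H) + (k * ((r + s) / r)) • frameOp μ f - B +
              ((r + s) / r) • frameOp μ f - w • rankOne ℂ (f x) (f x) := by
          push_cast
          module
        beta_reduce
        rw [e]
        exact ⟨h.1, h.2.trans hΦ⟩
    · rintro B ⟨hP, hΦ⟩ v
      have h₁ := (quadForm_frameOp_le_potential_mul hf hP v).trans
        (mul_le_mul_of_nonneg_right hΦ (quadForm_nonneg hP.nonneg v))
      rw [quadForm_sub, quadForm_add, quadForm_smul, quadForm_smul, quadForm_one] at h₁
      rw [hsqrt]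
      have hT' : T = (s ^ 2 + 1) * l := by rw [hs]; field_simp; ring
      rw [← hr, hT', div_mul_eq_mul_div, le_div_iff₀ (by positivity)] at h₁
      rw [← hr]
      have e : r ^ 2 * ((1 + s / r) ^ 2 * l) * ‖v‖ ^ 2 = (r + s) ^ 2 * l * ‖v‖ ^ 2 := by
        field_simp
      have e₂ : s * ((s ^ 2 + 1) * l * (r + s) / s * ‖v‖ ^ 2 +
          r ^ 2 * ((r + s) / r) * quadForm (frameOp μ f) v - quadForm B v) =
          (s ^ 2 + 1) * l * (r + s) * ‖v‖ ^ 2 +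
          s * r * (r + s) * quadForm (frameOp μ f) v - s * quadForm B v := by
        field_simp
      rw [e₂] at h₁
      rw [e]
      refine le_of_mul_le_mul_left ?_ hs0
      -- After the extra slack is used, `K` has coefficient `(r + s)(r - 1 / s)`. It is nonnegative
      -- because `n t > 1`, so `K ≤ l` may be inserted.
      have h₃ : (r * s - 1) * (r + s) * quadForm (frameOp μ f) v ≤
          (r * s - 1) * (r + s) * (l * ‖v‖ ^ 2) :=
        mul_le_mul_of_nonneg_left (hKl v) (mul_nonneg (by linarith) (by positivity))
      linarith

end Invariants

/-! ### Extremal eigenvalues and quadratic forms. -/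

section Eigenvalues

variable {H : Type*} [NormedAddCommGroup H] [InnerProductSpace ℂ H] [CompleteSpace H]

/-- The real eigenvalues of a bounded operator. -/
def realEigenvalues (T : H →L[ℂ] H) : Set ℝ := {t | ∃ v, v ≠ 0 ∧ T v = (t : ℂ) • v}

omit [CompleteSpace H] in
lemma quadForm_of_eigenvector {T : H →L[ℂ] H} {t : ℝ} {v : H} (h : T v = (t : ℂ) • v) :
    quadForm T v = t * ‖v‖ ^ 2 := by
  rw [quadForm, h, inner_smul_right, Complex.re_ofReal_mul]
  congr 1
  exact inner_self_eq_norm_sq (𝕜 := ℂ) v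

/-- A positive compact operator on a nontrivial Hilbert space has a largest eigenvalue: its
norm. -/
lemma isGreatest_realEigenvalues_norm [Nontrivial H] {T : H →L[ℂ] H} (hT : IsCompactOperator T)
    (hT0 : 0 ≤ T) : IsGreatest (realEigenvalues T) ‖T‖ := by
  refine ⟨?_, ?_⟩
  · rcases eq_or_ne T 0 with rfl | hne
    · obtain ⟨v, hv⟩ := exists_ne (0 : H)
      exact ⟨v, hv, by simp⟩
    · have hnorm : ((‖T‖ : ℝ) : ℂ) ≠ 0 := by simpa using hne
      have hspec : ((‖T‖ : ℝ) : ℂ) ∈ spectrum ℂ T := by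
        -- If `‖T‖` were in the resolvent set, Rayleigh quotients would stay below `‖T‖ - ε`, yet
        -- their supremum is `‖T‖`.
        by_contra hmem
        obtain ⟨ε, hε, h⟩ := T.rayleighQuotient_le_of_norm_mem_resolventSet
          (by simpa [spectrum] using hmem)
        have hpos : ∀ x, 0 ≤ T.rayleighQuotient x := fun x =>
          div_nonneg (((ContinuousLinearMap.nonneg_iff_isPositive T).1 hT0).re_inner_nonneg_left x)
            (sq_nonneg _)
        have := T.norm_eq_iSup_rayleighQuotient
          ((ContinuousLinearMap.nonneg_iff_isPositive T).1 hT0).isSymmetric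
        have hle : ⨆ x, |T.rayleighQuotient x| ≤ ‖T‖ - ε :=
          ciSup_le fun x => by rw [abs_of_nonneg (hpos x)]; exact h x
        linarith
      obtain ⟨v, hv⟩ := ((hT.hasEigenvalue_iff_mem_spectrum hnorm).2 hspec).exists_hasEigenvector
      exact ⟨v, hv.2, hv.apply_eq_smul⟩
  · rintro t ⟨v, hv, h⟩
    have h₁ := abs_quadForm_le T v
    rw [quadForm_of_eigenvector h] at h₁
    exact le_of_mul_le_mul_right ((le_abs_self _).trans h₁) (by positivity)

lemma bddBelow_realEigenvalues {T : H →L[ℂ] H} (hT : 0 ≤ T) : BddBelow (realEigenvalues T) := by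
  refine ⟨0, ?_⟩
  rintro t ⟨v, hv, h⟩
  have h₁ := quadForm_nonneg hT v
  rw [quadForm_of_eigenvector h] at h₁
  exact nonneg_of_mul_nonneg_left h₁ (by positivity)

section FiniteDimensional

variable [FiniteDimensional ℂ H] [Nontrivial H]

omit [CompleteSpace H] in
lemma iInf_rayleigh_mem_realEigenvalues {T : H →L[ℂ] H} (hT : (T : H →ₗ[ℂ] H).IsSymmetric) :
    (⨅ x : {x : H // x ≠ 0}, (inner ℂ (T x) (x : H)).re / ‖(x : H)‖ ^ 2) ∈ realEigenvalues T := by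
  obtain ⟨v, hv⟩ := hT.hasEigenvalue_iInf_of_finiteDimensional.exists_hasEigenvector
  exact ⟨v, hv.2, hv.apply_eq_smul⟩

lemma sInf_realEigenvalues_mul_le {T : H →L[ℂ] H} (hT : 0 ≤ T) (v : H) :
    sInf (realEigenvalues T) * ‖v‖ ^ 2 ≤ quadForm T v := by
  rcases eq_or_ne v 0 with rfl | hv
  · simp [quadForm]
  have hpos := (ContinuousLinearMap.nonneg_iff_isPositive T).1 hT
  have h₁ := csInf_le (bddBelow_realEigenvalues hT)
    (iInf_rayleigh_mem_realEigenvalues hpos.isSymmetric)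
  have h₂ : (⨅ x : {x : H // x ≠ 0}, (inner ℂ (T x) (x : H)).re / ‖(x : H)‖ ^ 2) ≤
      (inner ℂ (T v) v).re / ‖v‖ ^ 2 :=
    ciInf_le (f := fun x : {x : H // x ≠ 0} => (inner ℂ (T x) (x : H)).re / ‖(x : H)‖ ^ 2)
      ⟨0, by
        rintro _ ⟨x, rfl⟩
        exact div_nonneg (hpos.re_inner_nonneg_left x) (sq_nonneg _)⟩ ⟨v, hv⟩
  have h₃ := h₁.trans h₂
  rw [le_div_iff₀ (by positivity), inner_map_comm_of_nonneg hT] at h₃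
  exact h₃

lemma mul_sInf_realEigenvalues_le {S T : H →L[ℂ] H} (hS : 0 ≤ S) (hT : 0 ≤ T) {c : ℝ}
    (hc : 0 ≤ c) (h : ∀ v, c * quadForm S v ≤ quadForm T v) :
    c * sInf (realEigenvalues S) ≤ sInf (realEigenvalues T) := by
  refine le_csInf ⟨_, iInf_rayleigh_mem_realEigenvalues
    ((ContinuousLinearMap.nonneg_iff_isPositive T).1 hT).isSymmetric⟩ ?_
  rintro t ⟨v, hv, htv⟩
  have h₁ := h v
  rw [quadForm_of_eigenvector htv] at h₁
  have h₂ := mul_le_mul_of_nonneg_left (sInf_realEigenvalues_mul_le hS v) hc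
  rw [← mul_assoc] at h₂
  exact le_of_mul_le_mul_right (h₂.trans h₁) (by positivity)

end FiniteDimensional

end Eigenvalues

/-! ### Infinite matrices as bounded operators on `ℓ₂`. -/

section Ell2

open InnerProductSpace

variable {ι : Type*}

lemma memℓp_two_iff {u : ι → ℂ} : Memℓp u 2 ↔ Summable fun k => ‖u k‖ ^ 2 := by
  rw [memℓp_gen_iff (by norm_num)]
  simp

lemma norm_sq_ell2 (v : Ell2 ι) : ‖v‖ ^ 2 = ∑' k, ‖v k‖ ^ 2 := by
  have := lp.norm_rpow_eq_tsum (p := 2) (by norm_num) v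
  simpa using this

/-- The `k`-th unit vector of `ℓ₂(ι)`. -/
noncomputable def ell2Single (k : ι) : Ell2 ι :=
  open Classical in lp.single 2 k (1 : ℂ)

lemma inner_ell2Single_left (k : ι) (v : Ell2 ι) : inner ℂ (ell2Single k) v = v k := by
  classical
  rw [ell2Single, lp.inner_single_left]
  simp

lemma inner_ell2Single_right (k : ι) (v : Ell2 ι) :
    inner ℂ v (ell2Single k) = conj (v k) := by
  rw [← inner_conj_symm, inner_ell2Single_left]

lemma hasSum_smul_ell2Single (v : Ell2 ι) : HasSum (fun k => v k • ell2Single k) v := by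
  classical
  have h := lp.hasSum_single (p := 2) (by norm_num) v
  have e : (fun k => v k • ell2Single k) = fun k => lp.single 2 k (v k) := by
    ext1 k
    rw [ell2Single, ← lp.single_smul, smul_eq_mul, mul_one]
  rwa [e]

instance [Nonempty ι] : Nontrivial (Ell2 ι) := by
  obtain ⟨k⟩ := ‹Nonempty ι›
  refine ⟨ell2Single k, 0, fun h => ?_⟩
  have h₁ : ell2Single k k = 1 := by
    classical
    exact lp.single_apply_self (E := fun _ : ι => ℂ) 2 k 1
  rw [h] at h₁
  exact zero_ne_one h₁

/-- A bounded operator on `ℓ₂(ι)` is represented by a possibly infinite matrix. -/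
def IsMatrixOf (A : Matrix ι ι ℂ) (T : Ell2 ι →L[ℂ] Ell2 ι) : Prop :=
  ∀ k l, A k l = T (ell2Single l) k

variable {A : Matrix ι ι ℂ} {T : Ell2 ι →L[ℂ] Ell2 ι}

/-- Continuity of `T` lets it act termwise on the expansion in unit vectors, so every row sum
converges. -/
lemma IsMatrixOf.isMulVecEll2_iff (h : IsMatrixOf A T) (v u : Ell2 ι) :
    IsMulVecEll2 A v u ↔ T v = u := by
  have key : ∀ k, HasSum (fun l => A k l * v l) (T v k) := by
    intro k
    have h₁ := ((lp.evalCLM ℂ (fun _ : ι => ℂ) 2 k).comp T).hasSum (hasSum_smul_ell2Single v)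
    have h₂ : ∀ l, ((lp.evalCLM ℂ (fun _ : ι => ℂ) 2 k).comp T) (v l • ell2Single l) =
        A k l * v l := by
      intro l
      rw [map_smul, h k l, smul_eq_mul, mul_comm]
      rfl
    simp only [h₂] at h₁
    exact h₁
  refine ⟨fun hu => lp.ext (funext fun k => (key k).unique (hu k)), ?_⟩
  rintro rfl
  exact key

lemma IsMatrixOf.eigenvaluesEll2_eq (h : IsMatrixOf A T) :
    eigenvaluesEll2 A = realEigenvalues T := by
  ext t
  simp only [eigenvaluesEll2, realEigenvalues, Set.mem_ofPred_eq, h.isMulVecEll2_iff]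

lemma IsMatrixOf.isGreatest_eigenvaluesEll2 [Nonempty ι] (h : IsMatrixOf A T)
    (hT : IsCompactOperator T) (hT0 : 0 ≤ T) :
    IsGreatest (eigenvaluesEll2 A) (lambdaMax A) ∧ lambdaMax A = ‖T‖ := by
  have hg := isGreatest_realEigenvalues_norm hT hT0
  have : lambdaMax A = ‖T‖ := by rw [lambdaMax, h.eigenvaluesEll2_eq, hg.csSup_eq]
  rw [this, h.eigenvaluesEll2_eq]
  exact ⟨hg, rfl⟩

lemma IsMatrixOf.quadForm_pos (h : IsMatrixOf A T) (hA : PosDefEll2 A) {v : Ell2 ι}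
    (hv : v ≠ 0) : 0 < quadForm T v := by
  obtain ⟨u, hu, hpos⟩ := hA.2 v hv
  rw [h.isMulVecEll2_iff] at hu
  rwa [quadForm, hu]

section Fin

variable {m : ℕ}

lemma memℓp_fin (u : Fin m → ℂ) : Memℓp u 2 := memℓp_two_iff.2 (Summable.of_finite)

lemma isMulVecEll2_fin_iff {A : Matrix (Fin m) (Fin m) ℂ} {v u : Ell2 (Fin m)} :
    IsMulVecEll2 A v u ↔ A.mulVec (v : Fin m → ℂ) = (u : Fin m → ℂ) := by
  simp only [IsMulVecEll2, funext_iff, Matrix.mulVec, dotProduct]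
  exact forall_congr' fun k => ⟨fun h => (hasSum_fintype _).unique h, fun h => h ▸ hasSum_fintype _⟩

lemma lambdaMin_eq_sInf (A : Matrix (Fin m) (Fin m) ℂ) :
    lambdaMin A = sInf (eigenvaluesEll2 A) := by
  rw [lambdaMin]
  congr 1
  ext t
  simp only [Set.mem_ofPred_eq, eigenvaluesEll2, isMulVecEll2_fin_iff]
  constructor
  · intro h
    obtain ⟨v, hv⟩ := h.exists_hasEigenvector
    have := hv.apply_eq_smul
    rw [Matrix.toLin'_apply] at this
    exact ⟨⟨v, memℓp_fin v⟩, fun h => hv.2 (congrArg Subtype.val h), this⟩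
  · rintro ⟨v, hv, h⟩
    refine Module.End.hasEigenvalue_of_hasEigenvector (x := (v : Fin m → ℂ))
      ⟨Module.End.mem_eigenspace_iff.2 ?_, fun h0 => hv (lp.ext h0)⟩
    rw [Matrix.toLin'_apply, h]
    rfl

lemma Matrix.PosDef.posDefEll2 {A : Matrix (Fin m) (Fin m) ℂ} (hA : A.PosDef) : PosDefEll2 A := by
  refine ⟨hA.1, fun v hv => ⟨⟨A.mulVec v, memℓp_fin _⟩, isMulVecEll2_fin_iff.2 rfl, ?_⟩⟩
  have h := hA.re_dotProduct_pos (x := (v : Fin m → ℂ)) fun h0 => hv (lp.ext h0)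
  rw [lp.inner_eq_tsum, tsum_fintype]
  simpa [dotProduct, mul_comm] using h

instance : FiniteDimensional ℂ (Ell2 (Fin m)) :=
  (lpPiLpₗᵢ (fun _ : Fin m => ℂ) ℂ (p := 2)).symm.toLinearEquiv.finiteDimensional

lemma finrank_ell2_fin : Module.finrank ℂ (Ell2 (Fin m)) = m := by
  rw [(lpPiLpₗᵢ (fun _ : Fin m => ℂ) ℂ (p := 2)).toLinearEquiv.finrank_eq]
  exact finrank_euclideanSpace_fin

end Fin

end Ell2

/-! ### Simultaneous frame bounds for weighted samples. -/

section WeightedFrameOperator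

open InnerProductSpace

variable {H : Type*} [NormedAddCommGroup H] [InnerProductSpace ℂ H] {n : ℕ}

/-- The operator `∑ᵢ wᵢ vᵢ vᵢ^*` of a finite weighted family of vectors. -/
noncomputable def weightedFrameOp (w : Fin n → ℝ) (v : Fin n → H) : H →L[ℂ] H :=
  ∑ i, w i • rankOne ℂ (v i) (v i)

lemma inner_weightedFrameOp (w : Fin n → ℝ) (v : Fin n → H) (x y : H) :
    inner ℂ x (weightedFrameOp w v y) =
      ∑ i, (w i : ℂ) * (inner ℂ x (v i) * inner ℂ (v i) y) := by
  simp only [weightedFrameOp, sum_apply, smul_apply, rankOne_apply, inner_sum, ← Complex.coe_smul,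
    inner_smul_right]
  exact Finset.sum_congr rfl fun i _ => by ring

lemma weightedFrameOp_mul_left (c : ℝ) (w : Fin n → ℝ) (v : Fin n → H) :
    weightedFrameOp (fun i => c * w i) v = c • weightedFrameOp w v := by
  simp only [weightedFrameOp, mul_smul, Finset.smul_sum]

lemma isCompactOperator_weightedFrameOp (w : Fin n → ℝ) (v : Fin n → H) :
    IsCompactOperator (weightedFrameOp w v) := by
  have : weightedFrameOp w v ∈ compactOperator (RingHom.id ℂ) H H :=
    Submodule.sum_mem _ fun i _ => by
      rw [← Complex.coe_smul]
      exact Submodule.smul_mem _ _ (isCompactOperator_rankOne _ _)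
  exact this

lemma weightedFrameOp_nonneg [CompleteSpace H] {w : Fin n → ℝ} (hw : ∀ i, 0 < w i)
    (v : Fin n → H) : 0 ≤ weightedFrameOp w v :=
  Finset.sum_nonneg fun i _ => smul_nonneg (hw i).le (rankOne_self_nonneg _)

/-- Simultaneous discretization of a lower frame bound in a finite-dimensional space and an upper
frame bound in an arbitrary Hilbert space. -/
theorem exists_simultaneous_frame_bounds {D H₁ H₂ : Type*} [MeasurableSpace D] {μ : Measure D}
    [NormedAddCommGroup H₁] [InnerProductSpace ℂ H₁] [CompleteSpace H₁] [FiniteDimensional ℂ H₁]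
    [Nontrivial H₁] [NormedAddCommGroup H₂] [InnerProductSpace ℂ H₂] [CompleteSpace H₂]
    [Nontrivial H₂] {f : D → H₁} (hf : MemLp f 2 μ) {g : D → H₂} (hg : MemLp g 2 μ)
    (hK₁ : ∀ v, v ≠ 0 → 0 < quadForm (frameOp μ f) v)
    (hK₂ : ∀ v, v ≠ 0 → 0 < quadForm (frameOp μ g) v) {l : ℝ} (hl : 0 < l)
    (hKl : ∀ v, quadForm (frameOp μ g) v ≤ l * ‖v‖ ^ 2) {p : D → Prop} (hp : ∀ᵐ x ∂μ, p x)
    (hn : Module.finrank ℂ H₁ ≤ n) :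
    ∃ (x : Fin n → D) (w : Fin n → ℝ), (∀ i, p (x i)) ∧ (∀ i, 0 < w i) ∧
      (∀ v, (1 - √(((Module.finrank ℂ H₁ : ℝ) - 1) / n)) ^ 2 * quadForm (frameOp μ f) v ≤
        quadForm (weightedFrameOp w fun i => f (x i)) v) ∧
      ∀ v, quadForm (weightedFrameOp w fun i => g (x i)) v ≤
        (1 + √(((∫ x, ‖g x‖ ^ 2 ∂μ) / l - 1) / n)) ^ 2 * l * ‖v‖ ^ 2 := by
  have hn1 : 1 ≤ n := (Nat.succ_le_of_lt Module.finrank_pos).trans hn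
  have hn0 : (0 : ℝ) < n := by exact_mod_cast hn1
  obtain ⟨PL, hPL0, hPL, hPLn⟩ := exists_lower_invariant hf hK₁ hn
  obtain ⟨PU, hPU0, hPU, hPUn⟩ := exists_upper_invariant hg hK₂ hl hKl hn1
  obtain ⟨x, w, hx, hw, hA, hB⟩ := exists_weighted_sample _ _ hp hPL0 hPU0 hPL hPU n
  -- Each step samples at unit mass, so the barrier bounds are `n` times too large.
  refine ⟨x, fun i => (n : ℝ)⁻¹ * w i, hx, fun i => mul_pos (inv_pos.2 hn0) (hw i),
    fun v => ?_, fun v => ?_⟩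
  · rw [weightedFrameOp_mul_left, quadForm_smul, le_inv_mul_iff₀ hn0, ← mul_assoc]
    exact hPLn _ hA v
  · rw [weightedFrameOp_mul_left, quadForm_smul, inv_mul_le_iff₀ hn0, ← mul_assoc]
    exact hPUn _ hB v

end WeightedFrameOperator

/-! ### From families of functions to `ℓ₂`-valued fields. -/

section VectorField

open InnerProductSpace ENNReal

variable {D ι : Type*}

open Classical in
/-- The `ℓ₂`-valued vector field of a family of functions, set to zero where the family is not
square-summable. -/
noncomputable def ell2Field (b : ι → D → ℂ) (x : D) : Ell2 ι :=
  if h : Memℓp (fun k => b k x) 2 then ⟨fun k => b k x, h⟩ else 0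

lemma ell2Field_apply {b : ι → D → ℂ} {x : D} (h : Memℓp (fun k => b k x) 2) (k : ι) :
    ell2Field b x k = b k x := by
  rw [ell2Field, dif_pos h]

lemma isMatrixOf_sampleMatrix {b : ι → D → ℂ} {n : ℕ} {x : Fin n → D} (w : Fin n → ℝ)
    (h : ∀ i, Memℓp (fun k => b k (x i)) 2) :
    IsMatrixOf (sampleMatrix x w b) (weightedFrameOp w fun i => ell2Field b (x i)) := by
  intro k l
  rw [← inner_ell2Single_left k, inner_weightedFrameOp]
  simp only [sampleMatrix, Matrix.of_apply, inner_ell2Single_right, inner_ell2Single_left,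
    ell2Field_apply (h _)]

lemma norm_sq_ell2Field {b : ι → D → ℂ} {x : D} (h : Memℓp (fun k => b k x) 2) :
    ‖ell2Field b x‖ ^ 2 = ∑' k, ‖b k x‖ ^ 2 := by
  rw [norm_sq_ell2]
  simp only [ell2Field_apply h]

variable [MeasurableSpace D] {μ : Measure D} {b : ι → D → ℂ}

lemma traceEll2_integralMatrix (μ : Measure D) (b : ι → D → ℂ) :
    traceEll2 (integralMatrix μ b) = ∑' k, ∫ x, ‖b k x‖ ^ 2 ∂μ := by
  refine tsum_congr fun k => ?_
  rw [integralMatrix, Matrix.of_apply, ← Complex.ofReal_re (∫ x, ‖b k x‖ ^ 2 ∂μ),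
    ← integral_complex_ofReal]
  congr 2 with x
  rw [Complex.mul_conj, Complex.normSq_eq_norm_sq]

lemma tsum_lintegral_enorm_ne_top (hb : ∀ k, MemLp (b k) 2 μ)
    (htr : Summable fun k => ∫ x, ‖b k x‖ ^ 2 ∂μ) :
    ∑' k, ∫⁻ x, ‖‖b k x‖ ^ 2‖ₑ ∂μ ≠ ∞ := by
  have h : ∀ k, ∫⁻ x, ‖‖b k x‖ ^ 2‖ₑ ∂μ = ENNReal.ofReal (∫ x, ‖b k x‖ ^ 2 ∂μ) := by
    intro k
    rw [ofReal_integral_eq_lintegral_ofReal ((hb k).integrable_norm_pow (by norm_num))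
      (ae_of_all _ fun x => by positivity)]
    refine lintegral_congr fun x => ?_
    rw [Real.enorm_of_nonneg (by positivity)]
  simp only [h]
  exact htr.tsum_ofReal_ne_top

variable [Countable ι]

/-- The functions `|b k|²` have summable `L₁` norms, hence converge absolutely almost everywhere.
Used as the side condition `p` in the selection, this puts every sampled vector in `ℓ₂`. -/
lemma ae_memℓp (hb : ∀ k, MemLp (b k) 2 μ) (htr : Summable fun k => ∫ x, ‖b k x‖ ^ 2 ∂μ) :
    ∀ᵐ x ∂μ, Memℓp (fun k => b k x) 2 := by
  have h := summable_norm_of_tsum_eLpNorm_ne_top (μ := μ) le_rfl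
    (f := fun k x => ‖b k x‖ ^ 2) (fun k => (hb k).1.norm.pow 2)
    (by simpa only [eLpNorm_one_eq_lintegral_enorm] using tsum_lintegral_enorm_ne_top hb htr)
  filter_upwards [h] with x hx
  rw [memℓp_two_iff]
  simpa using hx

/-- The field is the almost everywhere limit of its finite partial sums; countability of `ι` makes
the net of finite sets countably generated. -/
lemma aestronglyMeasurable_ell2Field (hb : ∀ k, MemLp (b k) 2 μ)
    (htr : Summable fun k => ∫ x, ‖b k x‖ ^ 2 ∂μ) : AEStronglyMeasurable (ell2Field b) μ := by
  refine aestronglyMeasurable_of_tendsto_ae (Filter.atTop : Filter (Finset ι))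
    (f := fun s x => ∑ k ∈ s, b k x • ell2Single k) (fun s => ?_) ?_
  · exact Finset.aestronglyMeasurable_fun_sum s fun k _ => (hb k).1.smul_const _
  · filter_upwards [ae_memℓp hb htr] with x hx
    have := hasSum_smul_ell2Single (ell2Field b x)
    simp only [ell2Field_apply hx] at this
    exact this

lemma memLp_ell2Field (hb : ∀ k, MemLp (b k) 2 μ)
    (htr : Summable fun k => ∫ x, ‖b k x‖ ^ 2 ∂μ) : MemLp (ell2Field b) 2 μ := by
  have hmeas := aestronglyMeasurable_ell2Field hb htr
  have hle : ∫⁻ x, ‖‖ell2Field b x‖ ^ 2‖ₑ ∂μ ≤ ∑' k, ∫⁻ x, ‖‖b k x‖ ^ 2‖ₑ ∂μ := by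
    have hm : ∀ k, AEMeasurable (fun x => ‖‖b k x‖ ^ 2‖ₑ) μ := fun k =>
      ((hb k).1.norm.aemeasurable.pow_const 2).enorm
    rw [← lintegral_tsum hm]
    refine lintegral_mono_ae ?_
    filter_upwards [ae_memℓp hb htr] with x hx
    rw [norm_sq_ell2Field hx]
    exact enorm_tsum_le_tsum_enorm
  have hsq : AEStronglyMeasurable (fun x => ‖ell2Field b x‖ ^ 2) μ :=
    (hmeas.norm.aemeasurable.pow_const 2).aestronglyMeasurable
  exact (memLp_two_iff_integrable_sq_norm hmeas).2
    ⟨hsq, hle.trans_lt (tsum_lintegral_enorm_ne_top hb htr).lt_top⟩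

lemma integral_norm_sq_ell2Field (hb : ∀ k, MemLp (b k) 2 μ)
    (htr : Summable fun k => ∫ x, ‖b k x‖ ^ 2 ∂μ) :
    ∫ x, ‖ell2Field b x‖ ^ 2 ∂μ = ∑' k, ∫ x, ‖b k x‖ ^ 2 ∂μ := by
  rw [integral_tsum_of_summable_integral_norm
    (fun k => (hb k).integrable_norm_pow (by norm_num)) (by simpa using htr)]
  refine integral_congr_ae ?_
  filter_upwards [ae_memℓp hb htr] with x hx
  exact norm_sq_ell2Field hx

lemma isMatrixOf_integralMatrix (hb : ∀ k, MemLp (b k) 2 μ)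
    (htr : Summable fun k => ∫ x, ‖b k x‖ ^ 2 ∂μ) :
    IsMatrixOf (integralMatrix μ b) (frameOp μ (ell2Field b)) := by
  intro k l
  rw [← inner_ell2Single_left k, inner_frameOp (memLp_ell2Field hb htr)]
  refine integral_congr_ae ?_
  filter_upwards [ae_memℓp hb htr] with x hx
  rw [inner_ell2Single_left, inner_ell2Single_right, ell2Field_apply hx, ell2Field_apply hx]

end VectorField

/-! ### Assembly of the theorem. -/

theorem theorem1p3 {D : Type*} [MeasurableSpace D] (μ : Measure D)
    {m : ℕ} (hm : 1 ≤ m) (a : Fin m → D → ℂ) (ha : ∀ j, MemLp (a j) 2 μ)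
    {ι : Type*} [Countable ι] [Nonempty ι] (b : ι → D → ℂ) (hb : ∀ k, MemLp (b k) 2 μ)
    (hI : (integralMatrix μ a).PosDef)
    (hJ : PosDefEll2 (integralMatrix μ b))
    (htr : Summable fun k => ∫ x, ‖b k x‖ ^ 2 ∂μ) :
    traceEll2 (integralMatrix μ b) = ∑' k, ∫ x, ‖b k x‖ ^ 2 ∂μ ∧
    IsGreatest (eigenvaluesEll2 (integralMatrix μ b)) (lambdaMax (integralMatrix μ b)) ∧
    ∀ n : ℕ, m ≤ n → ∃ (x : Fin n → D) (w : Fin n → ℝ),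
      (∀ i, 0 < w i) ∧
      lambdaMin (sampleMatrix x w a) ≥
        (1 - √(((m : ℝ) - 1) / n)) ^ 2 * lambdaMin (integralMatrix μ a) ∧
      (∀ i, Memℓp (fun k => b k (x i)) 2) ∧
      IsGreatest (eigenvaluesEll2 (sampleMatrix x w b)) (lambdaMax (sampleMatrix x w b)) ∧
      lambdaMax (sampleMatrix x w b) ≤
        (1 + √((effectiveDim (integralMatrix μ b) - 1) / n)) ^ 2 *
          lambdaMax (integralMatrix μ b) := by
  have : NeZero m := ⟨by omega⟩
  have htra : Summable fun j => ∫ x, ‖a j x‖ ^ 2 ∂μ := Summable.of_finite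
  have hfa := memLp_ell2Field ha htra
  have hfb := memLp_ell2Field hb htr
  have hMa := isMatrixOf_integralMatrix ha htra
  have hMb := isMatrixOf_integralMatrix hb htr
  have hKa : ∀ v, v ≠ 0 → 0 < quadForm (frameOp μ (ell2Field a)) v := fun v hv =>
    hMa.quadForm_pos hI.posDefEll2 hv
  have hKb : ∀ v, v ≠ 0 → 0 < quadForm (frameOp μ (ell2Field b)) v := fun v hv =>
    hMb.quadForm_pos hJ hv
  obtain ⟨hgreat, hnorm⟩ :=
    hMb.isGreatest_eigenvaluesEll2 (isCompactOperator_frameOp hfb) (frameOp_nonneg hfb)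
  have htrace := traceEll2_integralMatrix μ b
  refine ⟨htrace, hgreat, fun n hn => ?_⟩
  have hl : 0 < lambdaMax (integralMatrix μ b) := by
    rw [hnorm, norm_pos_iff]
    intro h0
    obtain ⟨v, hv⟩ := exists_ne (0 : Ell2 ι)
    have := hKb v hv
    simp [h0] at this
  have hKl : ∀ v, quadForm (frameOp μ (ell2Field b)) v ≤
      lambdaMax (integralMatrix μ b) * ‖v‖ ^ 2 := fun v => by
    rw [hnorm]
    exact (le_abs_self _).trans (abs_quadForm_le _ v)
  obtain ⟨x, w, hx, hw, hA, hB⟩ := exists_simultaneous_frame_bounds hfa hfb hKa hKb hl hKl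
    (ae_memℓp hb htr) (n := n) (by rwa [finrank_ell2_fin])
  rw [finrank_ell2_fin] at hA
  rw [integral_norm_sq_ell2Field hb htr, ← htrace] at hB
  have hSa := isMatrixOf_sampleMatrix (b := a) (x := x) w fun i => memℓp_fin _
  have hSb := isMatrixOf_sampleMatrix w hx
  obtain ⟨hgs, -⟩ := hSb.isGreatest_eigenvaluesEll2
    (isCompactOperator_weightedFrameOp _ _) (weightedFrameOp_nonneg hw _)
  refine ⟨x, w, hw, ?_, hx, hgs, ?_⟩
  · rw [lambdaMin_eq_sInf, lambdaMin_eq_sInf, hSa.eigenvaluesEll2_eq, hMa.eigenvaluesEll2_eq]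
    exact mul_sInf_realEigenvalues_le (frameOp_nonneg hfa) (weightedFrameOp_nonneg hw _)
      (sq_nonneg _) hA
  -- The largest eigenvalue is attained, so the upper form bound is tested on its eigenvector.
  · obtain ⟨v, hv, hvt⟩ := hSb.eigenvaluesEll2_eq ▸ hgs.1
    refine le_of_mul_le_mul_right ?_ (pow_pos (norm_pos_iff.2 hv) 2)
    rw [← quadForm_of_eigenvector hvt]
    exact hB v
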